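/- Let $N\ge 2$, $0<s<1$, $1\le p<\infty$, and write points of $\mathbb R^N$ as $x=(x',x_N)$ with $x'\in\mathbb R^{N-1}$, $x_N\in\mathbb R$. Let $\varphi\in C^\infty(\mathbb R^{N-1})$ be a real-valued function that vanishes outside the closed unit ball and satisfies $\int\varphi=1$. For a function $\eta:\mathbb R^{N-1}\to[0,\infty)$ put $\Omega_\eta=\{(x',x_N): 0<x_N<\eta(x')\}$, and for measurable $g:\mathbb R^{N-1}\to\mathbb R$ put $$|g|_{\le\eta/2}=\Big(\int_{\mathbb R^{N-1}}\int_{\{|x'-y'|<\eta(x')/2\}}\frac{|g(x')-g(y')|^p}{|x'-y'|^{N-2+sp}}\,dy'\,dx'\Big)^{1/p},$$ $$|g|_{\ge\eta/2}=\Big(\int_{\mathbb R^{N-1}}\int_{\{|x'-y'|\ge\eta(x')/2\}}\eta(x')\,\eta(y')\frac{|g(x')-g(y')|^p}{|x'-y'|^{N+sp}}\,dy'\,dx'\Big)^{1/p}$$ (the short-range seminorm of order $s-1/p$ and the weighted long-range seminorm of order $s+1/p$, since $N-2+sp=(N-1)+(s-\frac1p)p$ and $N+sp=(N-1)+(s+\frac1p)p$).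 For $u:\Omega_\eta\to\mathbb R$ let $$|u|_{\dot W^{s,p}(\Omega_\eta)}=\Big(\int_{\Omega_\eta}\int_{\Omega_\eta}\frac{|u(x)-u(y)|^p}{|x-y|^{N+sp}}\,dy\,dx\Big)^{1/p},$$ and let $\dot W^{s,p}(\Omega_\eta)$ be the space of all $u\in L^p_{\mathrm{loc}}(\Omega_\eta)$ for which this is finite. For $g\in L^p_{\mathrm{loc}}(\mathbb R^{N-1})$, $x'\in\mathbb R^{N-1}$ and $x_N>0$ define $$u_g(x',x_N)=\int_{\mathbb R^{N-1}}\varphi(w')\,g\big(x'+\tfrac{x_N}{8}w'\big)\,dw'.$$ Then this integral converges absolutely and $g\mapsto u_g$ is linear. Moreover there is a constant $C>0$, depending only on $N$, $s$, $p$ and the fixed function $\varphi$, such that for every $1$-Lipschitz $\eta:\mathbb R^{N-1}\to[0,\infty)$ and every $g\in L^p_{\mathrm{loc}}(\mathbb R^{N-1})$ with $|g|_{\le\eta/2}<\infty$ and $|g|_{\ge\eta/2}<\infty$ one has $u_g\in\dot W^{s,p}(\Omega_\eta)$ and $$C\,|u_g|_{\dot W^{s,p}(\Omega_\eta)}\le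 |g|_{\le\eta/2}+|g|_{\ge\eta/2}.$$ -/

import Mathlib

open MeasureTheory
open scoped ENNReal ContDiff

noncomputable section

namespace OneSided

/-- The horizontal space `ℝ^{N-1}`, where `N = n + 1`. -/
abbrev Horiz (n : ℕ) : Type := EuclideanSpace ℝ (Fin n)

/-- The space `ℝ^N = ℝ^{N-1} × ℝ`, whose points are written `x = (x', x_N)`; it carries Lebesgue
(product) measure and the product topology. Its Euclidean distance is `eDist` below. -/
abbrev Total (n : ℕ) : Type := Horiz n × ℝ

/-- Euclidean distance on `ℝ^{N-1} × ℝ` (the `dist` of the product type is the maximum one). -/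
def eDist {n : ℕ} (x y : Total n) : ℝ :=
  Real.sqrt (‖x.1 - y.1‖ ^ 2 + (x.2 - y.2) ^ 2)

/-- `Ω = {(x', x_N) : 0 < x_N < η(x')}`. -/
def stripDomain {n : ℕ} (η : Horiz n → ℝ) : Set (Total n) :=
  {x | 0 < x.2 ∧ x.2 < η x.1}

/-- `f ∈ L^p_loc(U)`: `f` is in `L^p(K)` for every compact `K ⊆ U`. -/
def MemLpLoc {X : Type*} [TopologicalSpace X] [MeasureSpace X]
    (p : ℝ) (U : Set X) (f : X → ℝ) : Prop :=
  ∀ K : Set X, IsCompact K → K ⊆ U → MemLp f (ENNReal.ofReal p) (volume.restrict K)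

/-- Gagliardo seminorm
`|u|_{Ẇ^{s,p}(Ω)} = (∫_Ω ∫_Ω |u(x) - u(y)|^p / ‖x - y‖^{N + s p} dy dx)^{1/p}`, with `N = n + 1`. -/
def gagliardo {n : ℕ} (s p : ℝ) (Ω : Set (Total n)) (u : Total n → ℝ) : ℝ≥0∞ :=
  (∫⁻ x in Ω, ∫⁻ y in Ω,
    ENNReal.ofReal (|u x - u y| ^ p / eDist x y ^ ((n : ℝ) + 1 + s * p))) ^ (1 / p)

/-- `u ∈ Ẇ^{s,p}(Ω)`. -/
def MemHomogeneousSobolev {n : ℕ} (s p : ℝ) (Ω : Set (Total n)) (u : Total n → ℝ) : Prop :=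
  MemLpLoc p Ω u ∧ gagliardo s p Ω u < ⊤

/-- Short-range seminorm of order `σ`:
`(∫ ∫_{|x'-y'| < η(x')/2} |g(x') - g(y')|^p / ‖x' - y'‖^{(N-1) + σ p} dy' dx')^{1/p}`. -/
def shortRange {n : ℕ} (σ p : ℝ) (η : Horiz n → ℝ) (g : Horiz n → ℝ) : ℝ≥0∞ :=
  (∫⁻ x : Horiz n, ∫⁻ y in Metric.ball x (η x / 2),
    ENNReal.ofReal (|g x - g y| ^ p / ‖x - y‖ ^ ((n : ℝ) + σ * p))) ^ (1 / p)

/-- Weighted long-range seminorm of order `σ`: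
`(∫ ∫_{|x'-y'| ≥ η(x')/2} η(x') η(y') |g(x') - g(y')|^p / ‖x' - y'‖^{(N-1) + σ p} dy' dx')^{1/p}`. -/
def longRange {n : ℕ} (σ p : ℝ) (η : Horiz n → ℝ) (g : Horiz n → ℝ) : ℝ≥0∞ :=
  (∫⁻ x : Horiz n, ∫⁻ y in (Metric.ball x (η x / 2))ᶜ,
    ENNReal.ofReal (η x * η y * (|g x - g y| ^ p / ‖x - y‖ ^ ((n : ℝ) + σ * p)))) ^ (1 / p)

/-- A mollifier on `ℝ^{N-1}`: smooth, supported in the closed unit ball, of integral one.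
(No sign is imposed.) -/
structure IsMollifier {n : ℕ} (φ : Horiz n → ℝ) : Prop where
  contDiff : ContDiff ℝ ∞ φ
  support_subset : Function.support φ ⊆ Metric.closedBall 0 1
  integral_eq_one : ∫ w, φ w = 1

/-- `u(x', x_N) = ∫ φ(w') g(x' + (x_N / 8) w') dw'`. -/
def extension {n : ℕ} (φ : Horiz n → ℝ) (g : Horiz n → ℝ) : Total n → ℝ :=
  fun x => ∫ w, φ w * g (x.1 + (x.2 / 8) • w)

end OneSided

end

/-! Distances on `Total n` are measured in the maximum norm, which is at most the Euclidean one and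
so only enlarges the kernel. With `q = n + 1 + s * p`, the double integral over the strip is split
according to whether `‖x - y‖ < x.2 / 16` or not.

Far pairs. Since `φ` has integral one, constants can be subtracted from `g`, and Jensen bounds `|u x
- u y|^p` by a double average of increments of `g` between points `X` and `Y` lying within `x.2 / 8`
of `x.1` and `y.2 / 8` of `y.1`. At fixed height, passing from `x.1` to `X` is a translation, so
Tonelli and a shear turn `X` and `Y` into the variables of integration. As `η` is 1-Lipschitz, the
heights stay below `8 / 7 * η` at the new points. The kernel becomes `max(a, b, ‖X - Y‖)^(-q)`.
Integrating it over all heights gives `‖X - Y‖^(2 - q)`, the short-range kernel; bounding it by `‖X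
- Y‖^(-q)` and multiplying by the admissible lengths gives the long-range kernel with its weight `η
X * η Y`. Either bound holds for every pair, so each is used on its own region
(`lintegral_farKernel_le`).

Near pairs. Both values of `u` are integrals of the same function against two rescaled copies of `φ`
differing by `O(‖x - y‖ / x.2)` (`IsMollifier.exists_extension_sub_le_of_near`). The gain softens
the singularity to `‖x - y‖^(p - q)`, integrable in dimension `n + 1` because `s < 1`. Integrating
in `y` leaves `x.2^(-(s * p))` times local increments of `g`; a shear and an integration over
heights reduce this to the short-range energy alone (`lintegral_nearKernel_le`). -/

noncomputable section

namespace OneSided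

open Set

/-! ### Integrals of powers and averaging -/

/-- Jensen-type bound for the integral of a function against a bounded weight. -/
lemma enorm_integral_mul_rpow_le {X : Type*} [MeasurableSpace X] {μ : Measure X} {p : ℝ}
    (hp : 1 ≤ p) {ψ h : X → ℝ} {S : Set X} (hS : MeasurableSet S)
    {M : ℝ} (hM : ∀ w, |ψ w| ≤ M) (hψ : ∀ w, w ∉ S → ψ w = 0) (hh : Measurable h) :
    ‖∫ w, ψ w * h w ∂μ‖ₑ ^ p ≤
      ENNReal.ofReal M ^ p * μ S ^ (p - 1) * ∫⁻ w in S, ‖h w‖ₑ ^ p ∂μ := by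
  have hp0 : 0 < p := by linarith
  have h1 : ‖∫ w, ψ w * h w ∂μ‖ₑ ≤ ENNReal.ofReal M * ∫⁻ w in S, ‖h w‖ₑ ∂μ := by
    calc ‖∫ w, ψ w * h w ∂μ‖ₑ ≤ ∫⁻ w, ‖ψ w * h w‖ₑ ∂μ := enorm_integral_le_lintegral_enorm _
      _ ≤ ∫⁻ w, S.indicator (fun w => ENNReal.ofReal M * ‖h w‖ₑ) w ∂μ := by
          refine lintegral_mono fun w => ?_
          by_cases hw : w ∈ S
          · rw [indicator_of_mem hw, enorm_mul]
            gcongr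
            rw [Real.enorm_eq_ofReal_abs]
            exact ENNReal.ofReal_le_ofReal (hM w)
          · simp [hψ w hw]
      _ = ENNReal.ofReal M * ∫⁻ w in S, ‖h w‖ₑ ∂μ := by
          rw [lintegral_indicator hS, lintegral_const_mul _ hh.enorm]
  have h2 : ∫⁻ w in S, ‖h w‖ₑ ∂μ ≤
      (∫⁻ w in S, ‖h w‖ₑ ^ p ∂μ) ^ (1 / p) * μ S ^ (1 - 1 / p) := by
    have := eLpNorm_le_eLpNorm_mul_rpow_measure_univ (μ := μ.restrict S) (p := 1)
      (q := ENNReal.ofReal p) (f := h) (by simpa using hp) hh.aestronglyMeasurable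
    rw [eLpNorm_one_eq_lintegral_enorm, eLpNorm_eq_lintegral_rpow_enorm_toReal (by simpa using hp0)
      (by simp)] at this
    simpa [ENNReal.toReal_ofReal hp0.le] using this
  calc ‖∫ w, ψ w * h w ∂μ‖ₑ ^ p
      ≤ (ENNReal.ofReal M * ((∫⁻ w in S, ‖h w‖ₑ ^ p ∂μ) ^ (1 / p) * μ S ^ (1 - 1 / p))) ^ p := by
        gcongr
        exact h1.trans (by gcongr)
    _ = _ := by
        rw [ENNReal.mul_rpow_of_nonneg _ _ hp0.le, ENNReal.mul_rpow_of_nonneg _ _ hp0.le,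
          ← ENNReal.rpow_mul, ← ENNReal.rpow_mul, one_div_mul_cancel hp0.ne', ENNReal.rpow_one,
          sub_mul, one_div_mul_cancel hp0.ne', one_mul]
        ring

/-- Splitting at `d`, the constant part contributes `d ^ (1 - r)` and the tail `d ^ (1 - r) / (r -
1)`. This is how heights are integrated out below. -/
lemma lintegral_max_rpow_le {r d : ℝ} (hr : 1 < r) (hd : 0 < d) :
    ∫⁻ a in Ioi (0 : ℝ), ENNReal.ofReal (max a d ^ (-r)) ≤
      ENNReal.ofReal (r / (r - 1) * d ^ (1 - r)) := by
  rw [← Ioc_union_Ioi_eq_Ioi hd.le]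
  refine (lintegral_union_le _ _ _).trans ?_
  have h1 : ∫⁻ a in Ioc 0 d, ENNReal.ofReal (max a d ^ (-r)) = ENNReal.ofReal (d ^ (1 - r)) := by
    rw [setLIntegral_congr_fun (g := fun _ => ENNReal.ofReal (d ^ (-r))) measurableSet_Ioc
      (fun a ha => by simp [max_eq_right ha.2]), setLIntegral_const, Real.volume_Ioc,
      ← ENNReal.ofReal_mul (by positivity), sub_zero, mul_comm, sub_eq_add_neg,
      Real.rpow_add hd, Real.rpow_one]
  have h2 : ∫⁻ a in Ioi d, ENNReal.ofReal (max a d ^ (-r)) =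
      ENNReal.ofReal (d ^ (1 - r) / (r - 1)) := by
    rw [setLIntegral_congr_fun (g := fun a => ENNReal.ofReal (a ^ (-r))) measurableSet_Ioi
      (fun a ha => by simp [max_eq_left (le_of_lt (mem_Ioi.1 ha))]),
      ← ofReal_integral_eq_lintegral_ofReal
        (integrableOn_Ioi_rpow_of_lt (by linarith) hd), integral_Ioi_rpow_of_lt (by linarith) hd]
    · congr 1
      rw [show -r + 1 = 1 - r by ring, ← neg_sub r 1, div_neg, neg_div, neg_neg]
    · filter_upwards [ae_restrict_mem measurableSet_Ioi] with a ha
      exact Real.rpow_nonneg (hd.le.trans (le_of_lt ha)) _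
  rw [h1, h2, ← ENNReal.ofReal_add (by positivity) (div_nonneg (by positivity) (by linarith))]
  refine ENNReal.ofReal_le_ofReal (le_of_eq ?_)
  have : r - 1 ≠ 0 := by linarith
  field_simp
  ring

/-- Change of variables for an affine map of a finite-dimensional space. -/
lemma lintegral_comp_add_smul {E : Type*} [NormedAddCommGroup E] [NormedSpace ℝ E]
    [MeasurableSpace E] [BorelSpace E] [FiniteDimensional ℝ E] (μ : Measure E)
    [μ.IsAddHaarMeasure] {f : E → ℝ≥0∞} (hf : Measurable f) (x : E) {c : ℝ} (hc : 0 < c) :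
    ∫⁻ w, f (x + c • w) ∂μ =
      ENNReal.ofReal (c ^ (-(Module.finrank ℝ E : ℝ))) * ∫⁻ z, f z ∂μ := by
  have h1 : ∫⁻ w, f (x + c • w) ∂μ = ∫⁻ z, f (x + z) ∂(Measure.map (fun w => c • w) μ) := 
    (lintegral_map (f := fun z => f (x + z)) (hf.comp (measurable_const_add x))
      (measurable_const_smul c)).symm
  rw [h1, Measure.map_addHaar_smul μ hc.ne', lintegral_smul_measure, lintegral_add_left_eq_self,
    abs_of_pos (by positivity), Real.rpow_neg hc.le, Real.rpow_natCast, smul_eq_mul]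

/-- A homogeneous function of degree larger than minus the dimension has finite integral over balls,
with the natural scaling. -/
lemma exists_lintegral_norm_rpow_le {E : Type*} [NormedAddCommGroup E] [NormedSpace ℝ E]
    [MeasurableSpace E] [BorelSpace E] [FiniteDimensional ℝ E] (μ : Measure E)
    [μ.IsAddHaarMeasure] (hd : 1 ≤ Module.finrank ℝ E) {α : ℝ}
    (hα : -(Module.finrank ℝ E : ℝ) < α) :
    ∃ C : ℝ≥0∞, C ≠ ⊤ ∧ ∀ (x : E) (a : ℝ), 0 < a →
      ∫⁻ y, (Metric.ball x a).indicator (fun y => ENNReal.ofReal (‖x - y‖ ^ α)) y ∂μ ≤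
        C * ENNReal.ofReal (a ^ ((Module.finrank ℝ E : ℝ) + α)) := by
  have hm : Measurable fun y : E => ‖y‖ ^ α := by fun_prop
  refine ⟨∫⁻ y in Metric.ball (0 : E) 1, ENNReal.ofReal (‖y‖ ^ α) ∂μ, ?_, fun x a ha => ?_⟩
  · have := integrableOn_ball_of_norm_le_rpow (μ := μ) (r := 1) hd (f := fun y : E => ‖y‖ ^ α)
      (C := 1) (α := -α) (by linarith) (Filter.Eventually.of_forall fun y => by
        simp [abs_of_nonneg (Real.rpow_nonneg (norm_nonneg y) α)]) hm.aestronglyMeasurable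
    have h2 := this.2
    rw [hasFiniteIntegral_iff_enorm] at h2
    refine (lt_of_le_of_lt (lintegral_mono fun y => ?_) h2).ne
    rw [Real.enorm_eq_ofReal_abs]
    exact ENNReal.ofReal_le_ofReal (le_abs_self _)
  · set F : E → ℝ≥0∞ := (Metric.ball x a).indicator (fun y => ENNReal.ofReal (‖x - y‖ ^ α))
    have hF : Measurable F := by
      refine Measurable.indicator ?_ measurableSet_ball
      exact ((measurable_const.sub measurable_id).norm.pow_const α).ennreal_ofReal
    have key := lintegral_comp_add_smul μ hF x ha
    have h3 : ∀ w, F (x + a • w) = ENNReal.ofReal (a ^ α) *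
        (Metric.ball (0 : E) 1).indicator (fun y => ENNReal.ofReal (‖y‖ ^ α)) w := by
      intro w
      have hw : x + a • w ∈ Metric.ball x a ↔ w ∈ Metric.ball (0 : E) 1 := by
        simp [norm_smul, abs_of_pos ha, ha]
      by_cases h : w ∈ Metric.ball (0 : E) 1
      · simp only [F]
        rw [indicator_of_mem h, indicator_of_mem (hw.2 h), ← ENNReal.ofReal_mul (by positivity)]
        simp [norm_smul, abs_of_pos ha, Real.mul_rpow ha.le (norm_nonneg w)]
      · simp only [F]
        rw [indicator_of_notMem h, indicator_of_notMem (fun h' => h (hw.1 h')), mul_zero]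
    simp_rw [h3] at key
    rw [lintegral_const_mul _ (hm.ennreal_ofReal.indicator measurableSet_ball),
      lintegral_indicator measurableSet_ball] at key
    have h4 : ∫⁻ y, F y ∂μ = ENNReal.ofReal (a ^ (Module.finrank ℝ E : ℝ)) *
        (ENNReal.ofReal (a ^ (-(Module.finrank ℝ E : ℝ))) * ∫⁻ y, F y ∂μ) := by
      rw [← mul_assoc, ← ENNReal.ofReal_mul (by positivity), ← Real.rpow_add ha]
      simp
    rw [h4, ← key, ← mul_assoc, ← ENNReal.ofReal_mul (by positivity), ← Real.rpow_add ha, mul_comm]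

/-! ### Elementary properties of the extension -/

section Mollifier

variable {n : ℕ} {φ : Horiz n → ℝ}

lemma IsMollifier.eq_zero (hφ : IsMollifier φ) {w : Horiz n} (hw : w ∉ Metric.closedBall 0 1) :
    φ w = 0 := by
  by_contra h
  exact hw (hφ.support_subset h)

lemma IsMollifier.hasCompactSupport (hφ : IsMollifier φ) : HasCompactSupport φ :=
  HasCompactSupport.intro (isCompact_closedBall 0 1) fun _ h => hφ.eq_zero h

lemma IsMollifier.exists_bound (hφ : IsMollifier φ) :
    ∃ M : ℝ, 0 < M ∧ (∀ w, |φ w| ≤ M) ∧ ∀ v w, |φ v - φ w| ≤ M * ‖v - w‖ := by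
  obtain ⟨M, hM⟩ := hφ.hasCompactSupport.exists_bound_of_continuous hφ.contDiff.continuous
  obtain ⟨K, hK⟩ := hφ.contDiff.lipschitzWith_of_hasCompactSupport hφ.hasCompactSupport (by simp)
  refine ⟨max M K + 1, ?_, fun w => ?_, fun v w => ?_⟩
  · have := le_max_right M K
    have := K.coe_nonneg
    linarith
  · have := hM w
    rw [Real.norm_eq_abs] at this
    linarith [le_max_left M (K : ℝ)]
  · have := hK.dist_le_mul v w
    rw [Real.dist_eq, dist_eq_norm] at this
    refine this.trans ?_
    gcongr
    linarith [le_max_right M (K : ℝ)]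

lemma MemLpLoc.locallyIntegrable {p : ℝ} (hp : 1 ≤ p) {g : Horiz n → ℝ}
    (hg : MemLpLoc p univ g) : LocallyIntegrable g := by
  rw [locallyIntegrable_iff]
  intro K hK
  have : IsFiniteMeasure (volume.restrict K : Measure (Horiz n)) :=
    ⟨by simpa using hK.measure_lt_top⟩
  exact (hg K hK (subset_univ _)).integrable (by simpa using hp)

lemma integral_comp_add_smul (x : Horiz n) {c : ℝ} (hc : 0 < c) (f : Horiz n → ℝ) :
    ∫ z, f (x + c • z) = (c ^ n)⁻¹ * ∫ z, f z := by
  rw [Measure.integral_comp_smul volume (fun z => f (x + z)) c, integral_add_left_eq_self,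
    abs_of_pos (by simp only [finrank_euclideanSpace, Fintype.card_fin]; positivity), smul_eq_mul]
  simp

lemma integrable_comp_add_smul (x : Horiz n) {c : ℝ} (hc : c ≠ 0) {f : Horiz n → ℝ}
    (hf : Integrable f) : Integrable fun z => f (x + c • z) :=
  (integrable_comp_smul_iff volume (fun z => f (x + z)) hc).2 (hf.comp_add_left x)

lemma IsMollifier.integrable_mul (hφ : IsMollifier φ) {g : Horiz n → ℝ}
    (hg : LocallyIntegrable g) (x : Horiz n) {c : ℝ} (hc : c ≠ 0) :
    Integrable fun w => φ w * g (x + c • w) := by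
  have hc' : c⁻¹ ≠ 0 := inv_ne_zero hc
  have hcont : Continuous fun z : Horiz n => φ (c⁻¹ • (z - x)) :=
    hφ.contDiff.continuous.comp (by fun_prop)
  have hsupp : HasCompactSupport fun z : Horiz n => φ (c⁻¹ • (z - x)) := by
    have := (hφ.hasCompactSupport.comp_smul hc').comp_homeomorph (Homeomorph.subRight x)
    exact this
  have h1 : Integrable fun z => φ (c⁻¹ • (z - x)) * g z :=
    hg.integrable_smul_left_of_hasCompactSupport hcont hsupp
  have h2 := integrable_comp_add_smul x hc h1
  simpa [smul_smul, inv_mul_cancel₀ hc] using h2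

/-- The substitution `w ↦ (a / c) • w + c⁻¹ • (x - y)` sends `y + c • w` to `x + a • w`. Averages
about different points and at different scales thus become integrals of one function against
different kernels. -/
lemma IsMollifier.integral_mul_rescale (h : Horiz n → ℝ) (x y : Horiz n) {a c : ℝ}
    (ha : 0 < a) (hc : 0 < c) :
    ∫ w, φ w * h (y + c • w) =
      ∫ w, ((a / c) ^ n * φ ((a / c) • w + c⁻¹ • (x - y))) * h (x + a • w) := by
  have hac : 0 < a / c := div_pos ha hc
  have := integral_comp_add_smul (c⁻¹ • (x - y)) hac (fun w => φ w * h (y + c • w))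
  have h1 : ∫ w, φ w * h (y + c • w) = (a / c) ^ n *
      ∫ z, φ (c⁻¹ • (x - y) + (a / c) • z) * h (y + c • (c⁻¹ • (x - y) + (a / c) • z)) := by
    rw [this, ← mul_assoc, mul_inv_cancel₀ (by positivity), one_mul]
  rw [h1, ← integral_const_mul]
  congr 1
  ext z
  have : y + c • (c⁻¹ • (x - y) + (a / c) • z) = x + a • z := by
    rw [smul_add, smul_smul, smul_smul, mul_inv_cancel₀ hc.ne', mul_div_cancel₀ _ hc.ne', one_smul]
    abel
  rw [this, add_comm (c⁻¹ • (x - y)), mul_assoc]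

lemma IsMollifier.integrable_rescale (hφ : IsMollifier φ) {h : Horiz n → ℝ}
    (hh : LocallyIntegrable h) (x y : Horiz n) {a c : ℝ} (ha : 0 < a) (hc : 0 < c) :
    Integrable fun w =>
      ((a / c) ^ n * φ ((a / c) • w + c⁻¹ • (x - y))) * h (x + a • w) := by
  have hac : 0 < a / c := div_pos ha hc
  have := (integrable_comp_add_smul (c⁻¹ • (x - y)) hac.ne'
    (hφ.integrable_mul hh y hc.ne')).const_mul ((a / c) ^ n)
  refine this.congr (Filter.Eventually.of_forall fun z => ?_)
  have : y + c • (c⁻¹ • (x - y) + (a / c) • z) = x + a • z := by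
    rw [smul_add, smul_smul, smul_smul, mul_inv_cancel₀ hc.ne', mul_div_cancel₀ _ hc.ne', one_smul]
    abel
  simp only
  rw [this, add_comm (c⁻¹ • (x - y)), mul_assoc]

lemma extension_linear (hφ : IsMollifier φ) {g₁ g₂ : Horiz n → ℝ}
    (h₁ : LocallyIntegrable g₁) (h₂ : LocallyIntegrable g₂) (a b : ℝ) {x : Total n}
    (hx : 0 < x.2) :
    extension φ (fun z => a * g₁ z + b * g₂ z) x =
      a * extension φ g₁ x + b * extension φ g₂ x := by
  have hx8 : x.2 / 8 ≠ 0 := by positivity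
  unfold extension
  rw [← integral_const_mul, ← integral_const_mul,
    ← integral_add ((hφ.integrable_mul h₁ x.1 hx8).const_mul a)
      ((hφ.integrable_mul h₂ x.1 hx8).const_mul b)]
  congr 1
  ext w
  ring

lemma extension_sub_const (hφ : IsMollifier φ) {g : Horiz n → ℝ}
    (hg : LocallyIntegrable g) (c : ℝ) {x : Total n} (hx : 0 < x.2) :
    extension φ g x - c = ∫ w, φ w * (g (x.1 + (x.2 / 8) • w) - c) := by
  have hx8 : x.2 / 8 ≠ 0 := by positivity
  have h1 : Integrable fun w => φ w * c :=
    (hφ.contDiff.continuous.integrable_of_hasCompactSupport hφ.hasCompactSupport).mul_const c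
  simp_rw [mul_sub]
  rw [integral_sub (hφ.integrable_mul hg x.1 hx8) h1, integral_mul_const, hφ.integral_eq_one,
    one_mul]
  rfl

/-- Equality holds at every point of positive height, because an invertible affine map pulls null
sets back to null sets. This permits replacing `g` by a measurable representative. -/
lemma extension_congr_ae {g g' : Horiz n → ℝ} (h : g =ᵐ[volume] g') {x : Total n}
    (hx : 0 < x.2) : extension φ g x = extension φ g' x := by
  have hx8 : x.2 / 8 ≠ 0 := by positivity
  refine integral_congr_ae ?_
  have hq : Measure.QuasiMeasurePreserving (fun w : Horiz n => x.1 + (x.2 / 8) • w) := by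
    refine (measurePreserving_add_left volume x.1).quasiMeasurePreserving.comp
      ⟨measurable_const_smul _, ?_⟩
    rw [Measure.map_addHaar_smul volume hx8]
    exact Measure.smul_absolutelyContinuous
  filter_upwards [hq.ae_eq h] with w hw
  simp only [Function.comp_apply] at hw
  rw [hw]

/-- After the change of variables all dependence on `x` sits in the continuous kernel, while `g` is
integrated over a fixed compact ball; heights positive on `K` keep the scale invertible. -/
lemma continuousOn_extension (hφ : IsMollifier φ) {g : Horiz n → ℝ}
    (hg : LocallyIntegrable g) {K : Set (Total n)} (hK : IsCompact K)
    (hpos : ∀ x ∈ K, 0 < x.2) : ContinuousOn (extension φ g) K := by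
  have key : ∀ x ∈ K, extension φ g x =
      ∫ z, g z * ((1 / (x.2 / 8)) ^ n * φ ((1 / (x.2 / 8)) • z + (x.2 / 8)⁻¹ • (0 - x.1))) := by
    intro x hx
    have := IsMollifier.integral_mul_rescale (φ := φ) g 0 x.1 one_pos
      (show 0 < x.2 / 8 from div_pos (hpos x hx) (by norm_num))
    simp only [zero_add, one_smul] at this
    unfold extension
    rw [this]
    congr 1
    ext z
    ring
  obtain ⟨R, hR⟩ := hK.isBounded.exists_norm_le
  refine ContinuousOn.congr ?_ key
  refine continuousOn_integral_bilinear_of_locally_integrable_of_compact_support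
    (ContinuousLinearMap.mul ℝ ℝ) (k := Metric.closedBall 0 (2 * R))
    (isCompact_closedBall _ _) ?_ ?_ (hg.integrableOn_isCompact (isCompact_closedBall _ _))
  · have h2 : ContinuousOn (fun q : Total n × Horiz n => (1 / (q.1.2 / 8)))
        (K ×ˢ univ) := by
      refine ContinuousOn.div₀ (by fun_prop) (by fun_prop) fun q hq => ?_
      have := hpos q.1 hq.1
      positivity
    have h3 : ContinuousOn (fun q : Total n × Horiz n => ((q.1.2 / 8)⁻¹))
        (K ×ˢ univ) := by
      refine h2.congr fun q hq => ?_
      simp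
    refine ContinuousOn.mul (h2.pow n) ?_
    refine hφ.contDiff.continuous.comp_continuousOn ?_
    exact (h2.smul (by fun_prop)).add (h3.smul (by fun_prop))
  · intro x z hx hz
    have hx0 : 0 < x.2 / 8 := div_pos (hpos x hx) (by norm_num)
    rw [hφ.eq_zero, mul_zero]
    intro hmem
    apply hz
    have hxR := hR x hx
    have h1 : ‖x.1‖ ≤ R := (norm_fst_le x).trans hxR
    have h2 : x.2 ≤ R := (le_abs_self _).trans ((norm_snd_le x).trans hxR)
    have h4 : (1 / (x.2 / 8)) • z + (x.2 / 8)⁻¹ • (0 - x.1) = (x.2 / 8)⁻¹ • (z - x.1) := by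
      rw [one_div, ← smul_add, zero_sub, sub_eq_add_neg]
    rw [h4, mem_closedBall_zero_iff, norm_smul, Real.norm_eq_abs, abs_of_pos (by positivity),
      inv_mul_le_iff₀ hx0, mul_one] at hmem
    rw [mem_closedBall_zero_iff]
    have := norm_sub_norm_le z x.1
    have : 0 < x.2 := hpos x hx
    linarith

lemma memLpLoc_extension {p : ℝ} (hφ : IsMollifier φ) {g : Horiz n → ℝ}
    (hg : LocallyIntegrable g) (η : Horiz n → ℝ) :
    MemLpLoc p (stripDomain η) (extension φ g) := by
  intro K hK hKU
  have hc := continuousOn_extension hφ hg hK fun x hx => (hKU hx).1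
  obtain ⟨C, hC⟩ := hK.exists_bound_of_continuousOn hc
  have : IsFiniteMeasure (volume.restrict K : Measure (Total n)) :=
    ⟨by simpa using hK.measure_lt_top⟩
  refine MemLp.of_bound (hc.aestronglyMeasurable hK.measurableSet) C ?_
  filter_upwards [ae_restrict_mem hK.measurableSet] with x hx using hC x hx

end Mollifier

/-! ### Pointwise bounds for differences of the extension -/

section Pointwise

variable {n : ℕ} {φ : Horiz n → ℝ}

/-- The normalisation `∫ φ = 1` moves `c` under the integral. Since `φ` may change sign, its sup
bound replaces the probability weight in Jensen's inequality. -/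
lemma IsMollifier.exists_extension_sub_const_le (hφ : IsMollifier φ) {p : ℝ} (hp : 1 ≤ p) :
    ∃ C : ℝ≥0∞, C ≠ ⊤ ∧ ∀ g : Horiz n → ℝ, Measurable g → LocallyIntegrable g →
      ∀ (x : Total n) (c : ℝ), 0 < x.2 → ‖extension φ g x - c‖ₑ ^ p ≤
        C * ∫⁻ w in Metric.closedBall (0 : Horiz n) 1, ‖g (x.1 + (x.2 / 8) • w) - c‖ₑ ^ p := by
  obtain ⟨M, -, hM, -⟩ := hφ.exists_bound
  refine ⟨ENNReal.ofReal M ^ p * volume (Metric.closedBall (0 : Horiz n) 1) ^ (p - 1), ?_, ?_⟩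
  · refine ENNReal.mul_ne_top (ENNReal.rpow_ne_top_of_nonneg (by linarith) (by simp)) ?_
    exact ENNReal.rpow_ne_top_of_nonneg (by linarith) measure_closedBall_lt_top.ne
  · intro g hgm hg x c hx
    rw [extension_sub_const hφ hg c hx]
    exact enorm_integral_mul_rpow_le hp Metric.isClosed_closedBall.measurableSet hM
      (fun w => hφ.eq_zero)
      ((hgm.comp ((measurable_const_smul _).const_add _)).sub_const c)

/-- The difference of two values of the extension is controlled by a double average. -/
lemma IsMollifier.exists_extension_sub_le (hφ : IsMollifier φ) {p : ℝ} (hp : 1 ≤ p) :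
    ∃ C : ℝ≥0∞, C ≠ ⊤ ∧ ∀ g : Horiz n → ℝ, Measurable g → LocallyIntegrable g →
      ∀ x y : Total n, 0 < x.2 → 0 < y.2 → ‖extension φ g x - extension φ g y‖ₑ ^ p ≤
        C * ∫⁻ w in Metric.closedBall (0 : Horiz n) 1, ∫⁻ v in Metric.closedBall (0 : Horiz n) 1,
          ‖g (x.1 + (x.2 / 8) • w) - g (y.1 + (y.2 / 8) • v)‖ₑ ^ p := by
  obtain ⟨C, hC, h⟩ := hφ.exists_extension_sub_const_le hp
  refine ⟨C * C, ENNReal.mul_ne_top hC hC, fun g hgm hg x y hx hy => ?_⟩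
  -- The one-point bound is used twice: first with `c` the value of the extension at `y`, then at
  -- `y` with `c` the value of `g` at each sampled point.
  refine (h g hgm hg x _ hx).trans ?_
  rw [mul_assoc]
  refine mul_le_mul_right ?_ C
  rw [← lintegral_const_mul' _ _ hC]
  gcongr with w
  rw [enorm_sub_rev]
  refine (h g hgm hg y _ hy).trans (le_of_eq ?_)
  simp_rw [enorm_sub_rev (g (y.1 + _))]

/-- Here `τ` stands for the relative distance `‖x - y‖ / x.2`. The prefactor changes by a power
difference, and the argument of `φ` moves by at most `9 * τ` from the dilation plus `9 * τ` from the
shift. -/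
lemma abs_rescaled_sub_le {M : ℝ} (hM : ∀ w, |φ w| ≤ M)
    (hL : ∀ v w, |φ v - φ w| ≤ M * ‖v - w‖) {β τ : ℝ} {w δ : Horiz n} (hβ0 : 0 ≤ β)
    (hβ : β ≤ 9) (h8 : |8 - β| ≤ 9 * τ) (hδ : ‖δ‖ ≤ 9 * τ) (hw : ‖w‖ ≤ 1) :
    |8 ^ n * φ ((8 : ℝ) • w) - β ^ n * φ (β • w + δ)| ≤
      (9 * n * 9 ^ (n - 1) + 18 * 9 ^ n) * M * τ := by
  have hM0 : 0 ≤ M := (abs_nonneg _).trans (hM 0)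
  have hτ : 0 ≤ τ := by linarith [abs_nonneg (8 - β)]
  have h1 : |(8 : ℝ) ^ n - β ^ n| ≤ 9 * τ * n * 9 ^ (n - 1) := by
    refine (abs_pow_sub_pow_le _ _ _).trans ?_
    gcongr
    refine max_le ?_ ?_
    · norm_num
    · rwa [abs_of_nonneg hβ0]
  have h2 : ‖(8 : ℝ) • w - (β • w + δ)‖ ≤ 18 * τ := by
    have : (8 : ℝ) • w - (β • w + δ) = (8 - β) • w - δ := by
      rw [sub_smul]; abel
    rw [this]
    refine (norm_sub_le _ _).trans ?_
    rw [norm_smul, Real.norm_eq_abs]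
    nlinarith [abs_nonneg (8 - β), norm_nonneg w]
  have h3 : (8 : ℝ) ^ n * φ ((8 : ℝ) • w) - β ^ n * φ (β • w + δ) =
      (8 ^ n - β ^ n) * φ ((8 : ℝ) • w) + β ^ n * (φ ((8 : ℝ) • w) - φ (β • w + δ)) := by ring
  rw [h3]
  calc _ ≤ |(8 : ℝ) ^ n - β ^ n| * |φ ((8 : ℝ) • w)| +
        β ^ n * |φ ((8 : ℝ) • w) - φ (β • w + δ)| := by
        refine (abs_add_le _ _).trans ?_
        rw [abs_mul, abs_mul, abs_of_nonneg (pow_nonneg hβ0 n)]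
    _ ≤ (9 * τ * n * 9 ^ (n - 1)) * M + 9 ^ n * (M * (18 * τ)) := by
        gcongr
        · exact hM _
        · exact (hL _ _).trans (by gcongr)
    _ = _ := by ring

/-- For two close points the difference of the values of the extension gains a factor. -/
lemma IsMollifier.exists_extension_sub_le_of_near (hφ : IsMollifier φ) {p : ℝ} (hp : 1 ≤ p) :
    ∃ C : ℝ≥0∞, C ≠ ⊤ ∧ ∀ g : Horiz n → ℝ, Measurable g → LocallyIntegrable g →
      ∀ x y : Total n, 0 < x.2 → ‖x - y‖ < x.2 / 16 →
        ‖extension φ g x - extension φ g y‖ₑ ^ p ≤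
        C * (ENNReal.ofReal (‖x - y‖ / x.2) ^ p *
          ∫⁻ w in Metric.closedBall (0 : Horiz n) (1 / 5),
          ∫⁻ v in Metric.closedBall (0 : Horiz n) 1,
          ‖g (x.1 + x.2 • w) - g (x.1 + (x.2 / 8) • v)‖ₑ ^ p) := by
  obtain ⟨C, hC, h⟩ := hφ.exists_extension_sub_const_le hp
  obtain ⟨M, hM0, hM, hL⟩ := hφ.exists_bound
  set K : ℝ := (9 * n * 9 ^ (n - 1) + 18 * 9 ^ n) * M with hK
  have hK0 : 0 ≤ K := by positivity
  set B : ℝ≥0∞ := volume (Metric.closedBall (0 : Horiz n) (1 / 5)) ^ (p - 1)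
  refine ⟨ENNReal.ofReal K ^ p * B * C, ?_, fun g hgm hg x y hx hxy => ?_⟩
  · refine ENNReal.mul_ne_top (ENNReal.mul_ne_top
      (ENNReal.rpow_ne_top_of_nonneg (by linarith) (by simp)) ?_) hC
    exact ENNReal.rpow_ne_top_of_nonneg (by linarith) measure_closedBall_lt_top.ne
  set t := ‖x - y‖ with ht
  have h1 : ‖x.1 - y.1‖ ≤ t := norm_fst_le (x - y)
  have h2 : |x.2 - y.2| ≤ t := norm_snd_le (x - y)
  obtain ⟨h2a, h2b⟩ := abs_le.1 h2
  have hy : 0 < y.2 := by linarith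
  -- Subtracting the value at `x` is harmless, since both rescaled kernels have integral one, and it
  -- makes the remaining integrand an increment.
  set c := extension φ g x with hc
  have hgc : LocallyIntegrable fun z => g z - c := hg.sub (locallyIntegrable_const c)
  have hx8 : 0 < x.2 / 8 := by positivity
  have hy8 : 0 < y.2 / 8 := by positivity
  set k : Horiz n → ℝ := fun w => (x.2 / (x.2 / 8)) ^ n *
      φ ((x.2 / (x.2 / 8)) • w + (x.2 / 8)⁻¹ • (x.1 - x.1)) -
    (x.2 / (y.2 / 8)) ^ n * φ ((x.2 / (y.2 / 8)) • w + (y.2 / 8)⁻¹ • (x.1 - y.1)) with hk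
  have hrep : c - extension φ g y = ∫ w, k w * (g (x.1 + x.2 • w) - c) := by
    have e1 := extension_sub_const hφ hg c hx
    have e2 := extension_sub_const hφ hg c hy
    rw [IsMollifier.integral_mul_rescale (fun z => g z - c) x.1 x.1 hx hx8] at e1
    rw [IsMollifier.integral_mul_rescale (fun z => g z - c) x.1 y.1 hx hy8] at e2
    have e3 : c - extension φ g y = (extension φ g x - c) - (extension φ g y - c) := by
      rw [← hc]; ring
    rw [e3, e1, e2, ← integral_sub (hφ.integrable_rescale hgc x.1 x.1 hx hx8)
      (hφ.integrable_rescale hgc x.1 y.1 hx hy8)]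
    congr 1
    ext w
    simp only [hk]
    ring
  have h8 : x.2 / (x.2 / 8) = 8 := by field_simp
  have hk' : ∀ w, k w = 8 ^ n * φ ((8 : ℝ) • w) -
      (x.2 / (y.2 / 8)) ^ n * φ ((x.2 / (y.2 / 8)) • w + (y.2 / 8)⁻¹ • (x.1 - y.1)) := by
    intro w
    simp [hk, h8]
  have hβ0 : 0 ≤ x.2 / (y.2 / 8) := by positivity
  have hβ : x.2 / (y.2 / 8) ≤ 9 := by
    rw [div_le_iff₀ hy8]; linarith
  have hτ : 8 * t / y.2 ≤ 9 * (t / x.2) := by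
    have ht0 : 0 ≤ t := norm_nonneg _
    rw [mul_div_assoc', div_le_div_iff₀ hy hx]
    nlinarith
  have hδ : ‖(y.2 / 8)⁻¹ • (x.1 - y.1)‖ ≤ 8 * t / y.2 := by
    rw [norm_smul, Real.norm_eq_abs, abs_of_pos (by positivity), inv_mul_le_iff₀ hy8]
    refine h1.trans (le_of_eq ?_)
    field_simp
  have h8β : |8 - x.2 / (y.2 / 8)| ≤ 8 * t / y.2 := by
    have : 8 - x.2 / (y.2 / 8) = -(8 / y.2 * (x.2 - y.2)) := by field_simp; ring
    rw [this, abs_neg, abs_mul, abs_of_pos (by positivity), div_mul_eq_mul_div]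
    gcongr
  have hsupp : ∀ w, w ∉ Metric.closedBall (0 : Horiz n) (1 / 5) → k w = 0 := by
    intro w hw
    rw [mem_closedBall_zero_iff, not_le] at hw
    rw [hk', hφ.eq_zero, hφ.eq_zero, mul_zero, mul_zero, sub_zero]
    · rw [mem_closedBall_zero_iff, not_le]
      have e1 := norm_sub_le_norm_add ((x.2 / (y.2 / 8)) • w) ((y.2 / 8)⁻¹ • (x.1 - y.1))
      have e2 : x.2 / (y.2 / 8) * (1 / 5) ≤ ‖(x.2 / (y.2 / 8)) • w‖ := by
        rw [norm_smul, Real.norm_eq_abs, abs_of_nonneg hβ0]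
        gcongr
      -- The radius `1 / 5` leaves room: `t < x.2 / 16` gives `8 / 5 - 8 / 16 = 11 / 10`, which
      -- exceeds the bound `17 / 16` on `y.2 / x.2`.
      have e3 : 1 < x.2 / (y.2 / 8) * (1 / 5) - 8 * t / y.2 := by
        have : x.2 / (y.2 / 8) * (1 / 5) - 8 * t / y.2 = (8 * x.2 / 5 - 8 * t) / y.2 := by
          field_simp
        rw [this, lt_div_iff₀ hy]
        linarith
      linarith
    · rw [mem_closedBall_zero_iff, not_le, norm_smul, Real.norm_eq_abs, abs_of_pos (by norm_num)]
      linarith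
  have hbound : ∀ w, |k w| ≤ K * (t / x.2) := by
    intro w
    by_cases hw : w ∈ Metric.closedBall (0 : Horiz n) (1 / 5)
    · rw [mem_closedBall_zero_iff] at hw
      rw [hk']
      exact abs_rescaled_sub_le hM hL hβ0 hβ (h8β.trans hτ) (hδ.trans hτ) (by linarith)
    · rw [hsupp w hw, abs_zero]
      positivity
  rw [hrep]
  refine (enorm_integral_mul_rpow_le hp Metric.isClosed_closedBall.measurableSet hbound hsupp
    ((hgm.comp ((measurable_const_smul _).const_add _)).sub_const c)).trans ?_
  -- The constant `c` is itself an average of `g` at scale `x.2 / 8`, so the one-point bound applies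
  -- again.
  have h5 : ∫⁻ w in Metric.closedBall (0 : Horiz n) (1 / 5), ‖g (x.1 + x.2 • w) - c‖ₑ ^ p ≤
      C * ∫⁻ w in Metric.closedBall (0 : Horiz n) (1 / 5),
          ∫⁻ v in Metric.closedBall (0 : Horiz n) 1,
          ‖g (x.1 + x.2 • w) - g (x.1 + (x.2 / 8) • v)‖ₑ ^ p := by
    rw [← lintegral_const_mul' _ _ hC]
    gcongr with w
    rw [enorm_sub_rev]
    refine (h g hgm hg x _ hx).trans (le_of_eq ?_)
    simp_rw [enorm_sub_rev (g (x.1 + (x.2 / 8) • _))]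
  refine (mul_le_mul_right h5 _).trans (le_of_eq ?_)
  rw [ENNReal.ofReal_mul hK0, ENNReal.mul_rpow_of_nonneg _ _ (by linarith)]
  ring

end Pointwise

/-! ### Integral estimates -/

section Integral

variable {n : ℕ}

/-- The `p`-th power of the increment of `g`. -/
def incr (p : ℝ) (g : Horiz n → ℝ) (X Y : Horiz n) : ℝ≥0∞ := ‖g X - g Y‖ₑ ^ p

lemma measurable_incr {p : ℝ} {g : Horiz n → ℝ} (hg : Measurable g) {α : Type*}
    [MeasurableSpace α] {F G : α → Horiz n} (hF : Measurable F) (hG : Measurable G) :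
    Measurable fun a => incr p g (F a) (G a) :=
  ((hg.comp hF).sub (hg.comp hG)).enorm.pow_const p

lemma incr_self {p : ℝ} (hp : 1 ≤ p) (g : Horiz n → ℝ) (X : Horiz n) : incr p g X X = 0 := by
  simp [incr, show 0 < p by linarith]

lemma incr_ne_top {p : ℝ} (hp : 1 ≤ p) (g : Horiz n → ℝ) (X Y : Horiz n) : incr p g X Y ≠ ⊤ :=
  ENNReal.rpow_ne_top_of_nonneg (by linarith) enorm_ne_top

/-- The `p`-th power of the short-range seminorm. -/
def shortEnergy (s p : ℝ) (η g : Horiz n → ℝ) : ℝ≥0∞ :=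
  ∫⁻ X : Horiz n, ∫⁻ Y in Metric.ball X (η X / 2),
    incr p g X Y * ENNReal.ofReal (‖X - Y‖ ^ (-((n : ℝ) + s * p - 1)))

/-- The `p`-th power of the weighted long-range seminorm. -/
def longEnergy (s p : ℝ) (η g : Horiz n → ℝ) : ℝ≥0∞ :=
  ∫⁻ X : Horiz n, ∫⁻ Y in (Metric.ball X (η X / 2))ᶜ,
    incr p g X Y * ENNReal.ofReal (η X * η Y * ‖X - Y‖ ^ (-((n : ℝ) + 1 + s * p)))

/-- At each fixed height the map is a horizontal translation. -/
lemma lintegral_shear {f : ℝ → Horiz n} (hf : Measurable f) {Φ : Total n → ℝ≥0∞}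
    (hΦ : Measurable Φ) : ∫⁻ x : Total n, Φ (x.1 + f x.2, x.2) = ∫⁻ x, Φ x := by
  rw [Measure.volume_eq_prod, lintegral_prod_symm _ (by fun_prop), lintegral_prod_symm _
    hΦ.aemeasurable]
  refine lintegral_congr fun a => ?_
  exact lintegral_add_right_eq_self (fun X => Φ (X, a)) (f a)

lemma lintegral_lintegral_swap_pairs {α β γ δ : Type*} [MeasurableSpace α] [MeasurableSpace β]
    [MeasurableSpace γ] [MeasurableSpace δ] {μ : Measure α} {ν : Measure β} {ρ : Measure γ}
    {τ : Measure δ} [SFinite μ] [SFinite ν] [SFinite ρ] [SFinite τ]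
    {F : α → β → γ → δ → ℝ≥0∞}
    (hF : Measurable fun z : (α × β) × (γ × δ) => F z.1.1 z.1.2 z.2.1 z.2.2) :
    ∫⁻ a, ∫⁻ b, ∫⁻ c, ∫⁻ d, F a b c d ∂τ ∂ρ ∂ν ∂μ =
      ∫⁻ c, ∫⁻ d, ∫⁻ a, ∫⁻ b, F a b c d ∂ν ∂μ ∂τ ∂ρ := by
  have h1 : ∀ a b, ∫⁻ c, ∫⁻ d, F a b c d ∂τ ∂ρ = ∫⁻ z, F a b z.1 z.2 ∂(ρ.prod τ) := by
    intro a b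
    rw [lintegral_prod (fun z : γ × δ => F a b z.1 z.2)
      (hF.comp (measurable_prodMk_left (x := (a, b)))).aemeasurable]
  have h2 : ∀ c d, ∫⁻ a, ∫⁻ b, F a b c d ∂ν ∂μ = ∫⁻ z, F z.1 z.2 c d ∂(μ.prod ν) := by
    intro c d
    rw [lintegral_prod (fun z : α × β => F z.1 z.2 c d)
      (hF.comp (measurable_prodMk_right (y := (c, d)))).aemeasurable]
  simp_rw [h1, h2]
  have h3 : Measurable fun z : α × β => ∫⁻ y, F z.1 z.2 y.1 y.2 ∂(ρ.prod τ) :=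
    hF.lintegral_prod_right'
  have h4 : Measurable fun y : γ × δ => ∫⁻ z, F z.1 z.2 y.1 y.2 ∂(μ.prod ν) :=
    hF.lintegral_prod_left'
  rw [← lintegral_prod (fun z : α × β => ∫⁻ y, F z.1 z.2 y.1 y.2 ∂(ρ.prod τ)) h3.aemeasurable,
    ← lintegral_prod (fun y : γ × δ => ∫⁻ z, F z.1 z.2 y.1 y.2 ∂(μ.prod ν)) h4.aemeasurable]
  exact lintegral_lintegral_swap hF.aemeasurable

lemma measurableSet_ball_radius {η : Horiz n → ℝ} (hη : Measurable η) :
    MeasurableSet {z : Horiz n × Horiz n | z.2 ∈ Metric.ball z.1 (η z.1 / 2)} := by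
  simp only [Metric.mem_ball]
  exact measurableSet_lt (by fun_prop) (by fun_prop)

/-- A double integral is bounded by the energies as soon as its integrand is. -/
lemma lintegral_le_of_le_energies {s p : ℝ} {η g : Horiz n → ℝ} (hη : Measurable η)
    (hg : Measurable g) {H : Horiz n → Horiz n → ℝ≥0∞} {C : ℝ≥0∞} (hC : C ≠ ⊤)
    (hS : ∀ X, ∀ Y ∈ Metric.ball X (η X / 2),
      H X Y ≤ C * (incr p g X Y * ENNReal.ofReal (‖X - Y‖ ^ (-((n : ℝ) + s * p - 1)))))
    (hL : ∀ X, ∀ Y ∈ (Metric.ball X (η X / 2))ᶜ,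
      H X Y ≤ C * (incr p g X Y *
        ENNReal.ofReal (η X * η Y * ‖X - Y‖ ^ (-((n : ℝ) + 1 + s * p))))) :
    ∫⁻ X, ∫⁻ Y, H X Y ≤ C * (shortEnergy s p η g + longEnergy s p η g) := by
  have hm : Measurable fun X : Horiz n => ∫⁻ Y in Metric.ball X (η X / 2),
      incr p g X Y * ENNReal.ofReal (‖X - Y‖ ^ (-((n : ℝ) + s * p - 1))) := by
    simp_rw [← lintegral_indicator (measurableSet_ball (x := _))]
    have : Measurable ({z : Horiz n × Horiz n | z.2 ∈ Metric.ball z.1 (η z.1 / 2)}.indicator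
        fun z => incr p g z.1 z.2 * ENNReal.ofReal (‖z.1 - z.2‖ ^ (-((n : ℝ) + s * p - 1)))) := by
      refine Measurable.indicator ?_ (measurableSet_ball_radius hη)
      exact (measurable_incr hg measurable_fst measurable_snd).mul (by fun_prop)
    exact this.lintegral_prod_right'
  rw [shortEnergy, longEnergy, ← lintegral_add_left hm, ← lintegral_const_mul' _ _ hC]
  refine lintegral_mono fun X => ?_
  simp only
  rw [mul_add, ← lintegral_const_mul' _ _ hC, ← lintegral_const_mul' _ _ hC,
    ← lintegral_add_compl (fun Y => H X Y) (measurableSet_ball (x := X) (ε := η X / 2))]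
  exact add_le_add (setLIntegral_mono' measurableSet_ball (hS X))
    (setLIntegral_mono' measurableSet_ball.compl (hL X))

/-- The joint maximum dominates both `max a d` and `max b d`, so giving half of the exponent to each
factorises the integral; `q / 2 > 1` makes both factors converge. -/
lemma lintegral_lintegral_max_rpow_le {q d : ℝ} (hq : 2 < q) (hd : 0 < d) :
    ∫⁻ a in Ioi (0 : ℝ), ∫⁻ b in Ioi (0 : ℝ), ENNReal.ofReal (max (max a b) d ^ (-q)) ≤
      ENNReal.ofReal ((q / (q - 2)) ^ 2 * d ^ (2 - q)) := by
  have hq2 : 1 < q / 2 := by linarith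
  have h1 : ∀ a b : ℝ, ENNReal.ofReal (max (max a b) d ^ (-q)) ≤
      ENNReal.ofReal (max a d ^ (-(q / 2))) * ENNReal.ofReal (max b d ^ (-(q / 2))) := by
    intro a b
    have ha : 0 < max a d := lt_max_of_lt_right hd
    have hb : 0 < max b d := lt_max_of_lt_right hd
    have hm : 0 < max (max a b) d := lt_max_of_lt_right hd
    rw [← ENNReal.ofReal_mul (by positivity)]
    refine ENNReal.ofReal_le_ofReal ?_
    have : -q = -(q / 2) + -(q / 2) := by ring
    rw [this, Real.rpow_add hm]
    gcongr ?_ * ?_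
    · exact Real.rpow_le_rpow_of_nonpos ha (max_le_max_right _ (le_max_left _ _)) (by linarith)
    · exact Real.rpow_le_rpow_of_nonpos hb (max_le_max_right _ (le_max_right _ _)) (by linarith)
  have hm : Measurable fun a : ℝ => ENNReal.ofReal (max a d ^ (-(q / 2))) := by fun_prop
  calc _ ≤ ∫⁻ a in Ioi (0 : ℝ), ∫⁻ b in Ioi (0 : ℝ), ENNReal.ofReal (max a d ^ (-(q / 2))) *
        ENNReal.ofReal (max b d ^ (-(q / 2))) := by
        gcongr with a b
        exact h1 a b
    _ = (∫⁻ a in Ioi (0 : ℝ), ENNReal.ofReal (max a d ^ (-(q / 2)))) *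
        ∫⁻ b in Ioi (0 : ℝ), ENNReal.ofReal (max b d ^ (-(q / 2))) := by
        simp_rw [lintegral_const_mul _ hm]
        rw [lintegral_mul_const _ hm]
    _ ≤ ENNReal.ofReal (q / 2 / (q / 2 - 1) * d ^ (1 - q / 2)) *
        ENNReal.ofReal (q / 2 / (q / 2 - 1) * d ^ (1 - q / 2)) := by
        gcongr <;> exact lintegral_max_rpow_le hq2 hd
    _ = _ := by
        have h0 : 0 < q / 2 - 1 := by linarith
        rw [← ENNReal.ofReal_mul (by positivity)]
        congr 1
        have e : d ^ (2 - q) = d ^ (1 - q / 2) * d ^ (1 - q / 2) := by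
          rw [← Real.rpow_add hd]; congr 1; ring
        have e2 : q / 2 / (q / 2 - 1) = q / (q - 2) := by
          have : q - 2 ≠ 0 := by linarith
          field_simp
        rw [e, e2]
        ring

end Integral

/-! ### Far pairs: shearing and integrating out both heights -/

section Far

variable {n : ℕ}

lemma lintegral_le_setLIntegral_of_le {α : Type*} [MeasurableSpace α] {μ : Measure α} {A : Set α}
    (hA : MeasurableSet A) {f g : α → ℝ≥0∞} (h : ∀ a ∈ A, f a ≤ g a) (h' : ∀ a ∉ A, f a = 0) :
    ∫⁻ a, f a ∂μ ≤ ∫⁻ a in A, g a ∂μ := by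
  rw [← lintegral_indicator hA]
  refine lintegral_mono fun a => ?_
  by_cases ha : a ∈ A
  · simpa [ha] using h a ha
  · simp [h' a ha]

open Classical in
/-- The kernel to which the interaction of distant points reduces after a change of variables. -/
def farKernel (q p : ℝ) (η g : Horiz n → ℝ) (x y : Total n) : ℝ≥0∞ :=
  if (0 < x.2 ∧ x.2 < 8 / 7 * η x.1) ∧ (0 < y.2 ∧ y.2 < 8 / 7 * η y.1) then
    ENNReal.ofReal (max (max x.2 y.2) ‖x.1 - y.1‖ ^ (-q)) * incr p g x.1 y.1 else 0

lemma measurable_farKernel {q p : ℝ} {η g : Horiz n → ℝ} (hη : Measurable η) (hg : Measurable g) :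
    Measurable fun z : Total n × Total n => farKernel q p η g z.1 z.2 := by
  unfold farKernel
  refine Measurable.ite ?_ ?_ measurable_const
  · have h1 : MeasurableSet {z : Total n × Total n | 0 < z.1.2} :=
      measurableSet_lt (by fun_prop) (by fun_prop)
    have h2 : MeasurableSet {z : Total n × Total n | z.1.2 < 8 / 7 * η z.1.1} :=
      measurableSet_lt (by fun_prop) (by fun_prop)
    have h3 : MeasurableSet {z : Total n × Total n | 0 < z.2.2} :=
      measurableSet_lt (by fun_prop) (by fun_prop)
    have h4 : MeasurableSet {z : Total n × Total n | z.2.2 < 8 / 7 * η z.2.1} :=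
      measurableSet_lt (by fun_prop) (by fun_prop)
    exact (h1.inter h2).inter (h3.inter h4)
  · exact Measurable.mul (by fun_prop) (measurable_incr hg (by fun_prop) (by fun_prop))

/-- The upper limits on the heights are dropped, so `η` disappears. The diagonal, where the power of
the distance is meaningless, carries a zero increment. -/
lemma lintegral_farKernel_fiber_le_short {q p : ℝ} (hp : 1 ≤ p) (hq : 2 < q) (η g : Horiz n → ℝ)
    (X Y : Horiz n) :
    ∫⁻ a : ℝ, ∫⁻ b : ℝ, farKernel q p η g (X, a) (Y, b) ≤
      ENNReal.ofReal ((q / (q - 2)) ^ 2 * ‖X - Y‖ ^ (2 - q)) * incr p g X Y := by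
  rcases eq_or_ne X Y with rfl | hXY
  · simp [farKernel, incr_self hp]
  have hd : 0 < ‖X - Y‖ := norm_pos_iff.2 (sub_ne_zero.2 hXY)
  have hne := incr_ne_top hp g X Y
  calc _ ≤ ∫⁻ a in Ioi (0 : ℝ), ∫⁻ b in Ioi (0 : ℝ),
        ENNReal.ofReal (max (max a b) ‖X - Y‖ ^ (-q)) * incr p g X Y := by
        refine lintegral_le_setLIntegral_of_le measurableSet_Ioi (fun a ha => ?_) fun a ha => ?_
        · refine lintegral_le_setLIntegral_of_le measurableSet_Ioi (fun b hb => ?_) fun b hb => ?_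
          · unfold farKernel
            split_ifs
            · exact le_rfl
            · exact zero_le
          · simp [farKernel, show ¬ 0 < b from hb]
        · simp [farKernel, show ¬ 0 < a from ha]
    _ = (∫⁻ a in Ioi (0 : ℝ), ∫⁻ b in Ioi (0 : ℝ),
        ENNReal.ofReal (max (max a b) ‖X - Y‖ ^ (-q))) * incr p g X Y := by
        simp_rw [lintegral_mul_const' _ _ hne]
    _ ≤ _ := by
        gcongr
        exact lintegral_lintegral_max_rpow_le hq hd

/-- Here the heights are dropped from the maximum instead and only their ranges count; the factor
`2` absorbs `(8 / 7) ^ 2`. -/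
lemma lintegral_farKernel_fiber_le_long {q p : ℝ} (hp : 1 ≤ p) (hq : 2 < q) {η : Horiz n → ℝ}
    (hη : ∀ x, 0 ≤ η x) (g : Horiz n → ℝ) (X Y : Horiz n) :
    ∫⁻ a : ℝ, ∫⁻ b : ℝ, farKernel q p η g (X, a) (Y, b) ≤
      ENNReal.ofReal (2 * (η X * η Y * ‖X - Y‖ ^ (-q))) * incr p g X Y := by
  rcases eq_or_ne X Y with rfl | hXY
  · simp [farKernel, incr_self hp]
  have hd : 0 < ‖X - Y‖ := norm_pos_iff.2 (sub_ne_zero.2 hXY)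
  have h1 := hη X
  have h2 := hη Y
  calc _ ≤ ∫⁻ a in Ioo (0 : ℝ) (8 / 7 * η X), ∫⁻ b in Ioo (0 : ℝ) (8 / 7 * η Y),
        ENNReal.ofReal (‖X - Y‖ ^ (-q)) * incr p g X Y := by
        refine lintegral_le_setLIntegral_of_le measurableSet_Ioo (fun a ha => ?_) fun a ha => ?_
        · refine lintegral_le_setLIntegral_of_le measurableSet_Ioo (fun b hb => ?_) fun b hb => ?_
          · unfold farKernel
            split_ifs
            · refine mul_le_mul_left (ENNReal.ofReal_le_ofReal ?_) _
              exact Real.rpow_le_rpow_of_nonpos hd (le_max_right _ _) (by linarith)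
            · exact zero_le
          · have : ¬ (0 < b ∧ b < 8 / 7 * η Y) := hb
            simp [farKernel, this]
        · have : ¬ (0 < a ∧ a < 8 / 7 * η X) := ha
          simp [farKernel, this]
    _ = ENNReal.ofReal ((8 / 7) ^ 2 * (η X * η Y * ‖X - Y‖ ^ (-q))) * incr p g X Y := by
        rw [setLIntegral_const, setLIntegral_const, Real.volume_Ioo, Real.volume_Ioo, sub_zero,
          sub_zero, mul_right_comm, mul_right_comm _ _ (ENNReal.ofReal (8 / 7 * η X)),
          ← ENNReal.ofReal_mul (by positivity), mul_right_comm,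
          ← ENNReal.ofReal_mul (by positivity)]
        congr 2
        ring
    _ ≤ _ := by
        refine mul_le_mul_left (ENNReal.ofReal_le_ofReal ?_) _
        refine mul_le_mul_of_nonneg_right (by norm_num) (by positivity)

/-- The exponents match because `2 - q = -(n + s * p - 1)`. The condition `q > 2` comes from `n ≥ 1`
and `s * p > 0`. -/
lemma lintegral_farKernel_le {s p : ℝ} (hn : 1 ≤ n) (hs : 0 < s) (hp : 1 ≤ p) {η g : Horiz n → ℝ}
    (hη : ∀ x, 0 ≤ η x) (hηm : Measurable η) (hg : Measurable g) {q : ℝ}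
    (hq : q = (n : ℝ) + 1 + s * p) :
    ∫⁻ x : Total n, ∫⁻ y : Total n, farKernel q p η g x y ≤
      ENNReal.ofReal ((q / (q - 2)) ^ 2 + 2) * (shortEnergy s p η g + longEnergy s p η g) := by
  have hn' : (1 : ℝ) ≤ n := by exact_mod_cast hn
  have hsp : 0 < s * p := by positivity
  have hq2 : 2 < q := by linarith
  have hm := measurable_farKernel (q := q) (p := p) hηm hg
  have h1 : ∫⁻ x : Total n, ∫⁻ y : Total n, farKernel q p η g x y =
      ∫⁻ X : Horiz n, ∫⁻ Y : Horiz n, ∫⁻ a : ℝ, ∫⁻ b : ℝ, farKernel q p η g (X, a) (Y, b) := by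
    rw [Measure.volume_eq_prod, lintegral_prod _ hm.lintegral_prod_right'.aemeasurable]
    refine lintegral_congr fun X => ?_
    have h2 : ∀ a : ℝ, ∫⁻ y : Total n, farKernel q p η g (X, a) y ∂(volume.prod volume) =
        ∫⁻ Y : Horiz n, ∫⁻ b : ℝ, farKernel q p η g (X, a) (Y, b) := fun a =>
      lintegral_prod (fun y => farKernel q p η g (X, a) y)
        (hm.comp measurable_prodMk_left).aemeasurable
    simp only [h2]
    rw [lintegral_lintegral_swap]
    · refine Measurable.aemeasurable ?_
      have : Measurable fun z : (ℝ × Horiz n) × ℝ =>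
          farKernel q p η g (X, z.1.1) (z.1.2, z.2) :=
        hm.comp (Measurable.prodMk (by fun_prop) (by fun_prop))
      exact this.lintegral_prod_right'
  rw [h1]
  refine lintegral_le_of_le_energies hηm hg ENNReal.ofReal_ne_top (fun X Y _ => ?_) fun X Y _ => ?_
  · refine (lintegral_farKernel_fiber_le_short hp hq2 η g X Y).trans ?_
    rw [mul_left_comm, ← ENNReal.ofReal_mul (by positivity), mul_comm (incr p g X Y),
      show 2 - q = -((n : ℝ) + s * p - 1) by rw [hq]; ring]
    refine mul_le_mul_left (ENNReal.ofReal_le_ofReal ?_) _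
    exact mul_le_mul_of_nonneg_right (by linarith) (by positivity)
  · refine (lintegral_farKernel_fiber_le_long hp hq2 hη g X Y).trans ?_
    have h1 := hη X
    have h2 := hη Y
    rw [mul_left_comm (ENNReal.ofReal ((q / (q - 2)) ^ 2 + 2)),
      ← ENNReal.ofReal_mul (by positivity), mul_comm (incr p g X Y), ← hq]
    refine mul_le_mul_left (ENNReal.ofReal_le_ofReal ?_) _
    refine mul_le_mul_of_nonneg_right ?_ (by positivity)
    linarith [sq_nonneg (q / (q - 2))]

lemma le_farKernel {q p : ℝ} (hq : 0 < q) {η : Horiz n → ℝ} (hη : LipschitzWith 1 η)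
    (g : Horiz n → ℝ) {x y : Total n} (hx : x ∈ stripDomain η) (hy : y ∈ stripDomain η)
    (hxy : x.2 / 16 ≤ ‖x - y‖) {w v : Horiz n} (hw : ‖w‖ ≤ 1) (hv : ‖v‖ ≤ 1) :
    ENNReal.ofReal (‖x - y‖ ^ (-q)) * incr p g (x.1 + (x.2 / 8) • w) (y.1 + (y.2 / 8) • v) ≤
      ENNReal.ofReal (17 ^ q) *
        farKernel q p η g (x.1 + (x.2 / 8) • w, x.2) (y.1 + (y.2 / 8) • v, y.2) := by
  obtain ⟨hx0, hx1⟩ := hx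
  obtain ⟨hy0, hy1⟩ := hy
  -- A horizontal move of length at most `a / 8` lowers `η` by at most `a / 8`, leaving more than `7
  -- / 8 * a`.
  have shift : ∀ (z u : Horiz n) (a : ℝ), 0 < a → a < η z → ‖u‖ ≤ 1 →
      a < 8 / 7 * η (z + (a / 8) • u) ∧ ‖(a / 8) • u‖ ≤ a / 8 := by
    intro z u a ha haz hu
    have h1 : ‖(a / 8) • u‖ ≤ a / 8 := by
      rw [norm_smul, Real.norm_eq_abs, abs_of_pos (by positivity)]
      nlinarith [norm_nonneg u]
    have h2 := hη.dist_le_mul z (z + (a / 8) • u)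
    rw [Real.dist_eq, dist_self_add_right, NNReal.coe_one, one_mul] at h2
    exact ⟨by linarith [(abs_le.1 h2).2], h1⟩
  obtain ⟨e1, e1'⟩ := shift x.1 w x.2 hx0 hx1 hw
  obtain ⟨e2, e2'⟩ := shift y.1 v y.2 hy0 hy1 hv
  rw [farKernel, if_pos ⟨⟨hx0, e1⟩, ⟨hy0, e2⟩⟩, ← mul_assoc,
    ← ENNReal.ofReal_mul (by positivity)]
  gcongr
  have h1 : ‖x.1 - y.1‖ ≤ ‖x - y‖ := norm_fst_le (x - y)
  have h2 : |x.2 - y.2| ≤ ‖x - y‖ := norm_snd_le (x - y)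
  have h3 := (abs_le.1 h2).1
  simp only
  set m := max (max x.2 y.2) ‖x.1 + (x.2 / 8) • w - (y.1 + (y.2 / 8) • v)‖ with hm
  have hm0 : 0 < m := lt_max_of_lt_left (lt_max_of_lt_left hx0)
  -- Farness gives `x.2 ≤ 16 * ‖x - y‖`, hence `y.2 ≤ 17 * ‖x - y‖`; the sheared horizontal distance
  -- is at most `(1 + 2 + 17 / 8) * ‖x - y‖`.
  have hm1 : m ≤ 17 * ‖x - y‖ := by
    refine max_le (max_le (by linarith) (by linarith)) ?_
    have : x.1 + (x.2 / 8) • w - (y.1 + (y.2 / 8) • v) =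
        (x.1 - y.1) + ((x.2 / 8) • w - (y.2 / 8) • v) := by abel
    rw [this]
    refine (norm_add_le _ _).trans ?_
    linarith [norm_sub_le ((x.2 / 8) • w) ((y.2 / 8) • v)]
  have h4 : ‖x - y‖ ^ (-q) ≤ (m / 17) ^ (-q) :=
    Real.rpow_le_rpow_of_nonpos (by positivity) (by linarith) (by linarith)
  refine h4.trans (le_of_eq ?_)
  rw [Real.div_rpow hm0.le (by norm_num), Real.rpow_neg (by norm_num : (0 : ℝ) ≤ 17), div_inv_eq_mul,
    mul_comm]

lemma measurableSet_stripDomain {η : Horiz n → ℝ} (hη : Measurable η) :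
    MeasurableSet (stripDomain η) :=
  (measurableSet_lt measurable_const measurable_snd).inter
    (measurableSet_lt measurable_snd (hη.comp measurable_fst))

/-- Once the averages over `w` and `v` are outermost, the two shears remove them from the integrand,
and they cost only the squared volume of the unit ball. -/
lemma exists_lintegral_far_le {s p : ℝ} (hn : 1 ≤ n) (hs : 0 < s) (hp : 1 ≤ p) :
    ∃ C : ℝ≥0∞, C ≠ ⊤ ∧ ∀ η g : Horiz n → ℝ, (∀ x, 0 ≤ η x) → LipschitzWith 1 η → Measurable g →
      ∫⁻ x in stripDomain η, ∫⁻ y in stripDomain η, (if ‖x - y‖ < x.2 / 16 then 0 else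
        ENNReal.ofReal (‖x - y‖ ^ (-((n : ℝ) + 1 + s * p))) *
        ∫⁻ w in Metric.closedBall (0 : Horiz n) 1, ∫⁻ v in Metric.closedBall (0 : Horiz n) 1,
          incr p g (x.1 + (x.2 / 8) • w) (y.1 + (y.2 / 8) • v)) ≤
      C * (shortEnergy s p η g + longEnergy s p η g) := by
  set q : ℝ := (n : ℝ) + 1 + s * p with hq
  have hq0 : 0 < q := by positivity
  set B := Metric.closedBall (0 : Horiz n) 1 with hB
  have hBm : MeasurableSet B := Metric.isClosed_closedBall.measurableSet
  refine ⟨ENNReal.ofReal (17 ^ q) * ((volume B * volume B) *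
    ENNReal.ofReal ((q / (q - 2)) ^ 2 + 2)), ?_, fun η g hη hηL hg => ?_⟩
  · have : volume B ≠ ⊤ := measure_closedBall_lt_top.ne
    finiteness
  have hηm : Measurable η := hηL.continuous.measurable
  have hΩ := measurableSet_stripDomain hηm
  have hm := measurable_farKernel (q := q) (p := p) hηm hg
  have hpt : ∀ x ∈ stripDomain η, ∀ y ∈ stripDomain η, (if ‖x - y‖ < x.2 / 16 then 0 else
        ENNReal.ofReal (‖x - y‖ ^ (-q)) * ∫⁻ w in B, ∫⁻ v in B,
          incr p g (x.1 + (x.2 / 8) • w) (y.1 + (y.2 / 8) • v)) ≤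
      ENNReal.ofReal (17 ^ q) * ∫⁻ w in B, ∫⁻ v in B,
        farKernel q p η g (x.1 + (x.2 / 8) • w, x.2) (y.1 + (y.2 / 8) • v, y.2) := by
    intro x hx y hy
    split_ifs with h
    · exact zero_le
    · rw [← lintegral_const_mul' _ _ ENNReal.ofReal_ne_top,
        ← lintegral_const_mul' _ _ ENNReal.ofReal_ne_top]
      refine setLIntegral_mono' hBm fun w hw => ?_
      rw [← lintegral_const_mul' _ _ ENNReal.ofReal_ne_top,
        ← lintegral_const_mul' _ _ ENNReal.ofReal_ne_top]
      refine setLIntegral_mono' hBm fun v hv => ?_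
      exact le_farKernel hq0 hηL g hx hy (not_lt.1 h) (mem_closedBall_zero_iff.1 hw)
        (mem_closedBall_zero_iff.1 hv)
  have hmeas : Measurable fun z : (Total n × Total n) × (Horiz n × Horiz n) =>
      farKernel q p η g (z.1.1.1 + (z.1.1.2 / 8) • z.2.1, z.1.1.2)
        (z.1.2.1 + (z.1.2.2 / 8) • z.2.2, z.1.2.2) :=
    hm.comp (Measurable.prodMk (by fun_prop) (by fun_prop))
  calc _ ≤ ∫⁻ x in stripDomain η, ∫⁻ y in stripDomain η,
        ENNReal.ofReal (17 ^ q) * ∫⁻ w in B, ∫⁻ v in B,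
        farKernel q p η g (x.1 + (x.2 / 8) • w, x.2) (y.1 + (y.2 / 8) • v, y.2) :=
        setLIntegral_mono' hΩ fun x hx => setLIntegral_mono' hΩ fun y hy => hpt x hx y hy
    _ ≤ ∫⁻ x : Total n, ∫⁻ y : Total n,
        ENNReal.ofReal (17 ^ q) * ∫⁻ w in B, ∫⁻ v in B,
        farKernel q p η g (x.1 + (x.2 / 8) • w, x.2) (y.1 + (y.2 / 8) • v, y.2) :=
        (setLIntegral_le_lintegral _ _).trans
          (lintegral_mono fun x => setLIntegral_le_lintegral _ _)
    _ = ENNReal.ofReal (17 ^ q) * ∫⁻ w in B, ∫⁻ v in B, ∫⁻ x : Total n, ∫⁻ y : Total n,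
        farKernel q p η g (x.1 + (x.2 / 8) • w, x.2) (y.1 + (y.2 / 8) • v, y.2) := by
        rw [← lintegral_lintegral_swap_pairs hmeas,
          ← lintegral_const_mul' _ _ ENNReal.ofReal_ne_top]
        refine lintegral_congr fun x => ?_
        rw [lintegral_const_mul' _ _ ENNReal.ofReal_ne_top]
    _ = ENNReal.ofReal (17 ^ q) * ∫⁻ w in B, ∫⁻ v in B, ∫⁻ x : Total n, ∫⁻ y : Total n,
        farKernel q p η g x y := by
        congr 1
        refine lintegral_congr fun w => lintegral_congr fun v => ?_
        rw [← lintegral_shear (f := fun a => (a / 8) • w) (by fun_prop)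
          (Φ := fun x => ∫⁻ y : Total n, farKernel q p η g x y) hm.lintegral_prod_right']
        refine lintegral_congr fun x => ?_
        exact lintegral_shear (f := fun a => (a / 8) • v) (by fun_prop)
          (Φ := fun y => farKernel q p η g (x.1 + (x.2 / 8) • w, x.2) y)
          (hm.comp measurable_prodMk_left)
    _ ≤ _ := by
        rw [setLIntegral_const, setLIntegral_const, mul_assoc (ENNReal.ofReal (17 ^ q)),
          mul_assoc (volume B * volume B), mul_assoc, mul_comm _ (volume B * volume B)]
        gcongr
        exact lintegral_farKernel_le hn hs hp hη hηm hg hq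

end Far

/-! ### Near pairs: reduction to the short-range energy -/

section Near

variable {n : ℕ}

open Classical in
/-- The kernel to which the interaction of close points reduces after a change of variables. -/
def nearKernel (s p : ℝ) (η g : Horiz n → ℝ) (x : Total n) (Y : Horiz n) : ℝ≥0∞ :=
  if (0 < x.2 ∧ x.2 < 5 / 4 * η x.1) ∧ ‖x.1 - Y‖ ≤ 13 / 40 * x.2 then
    ENNReal.ofReal (x.2 ^ (-((n : ℝ) + s * p))) * incr p g x.1 Y else 0

lemma measurable_nearKernel {s p : ℝ} {η g : Horiz n → ℝ} (hη : Measurable η)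
    (hg : Measurable g) : Measurable fun z : Total n × Horiz n => nearKernel s p η g z.1 z.2 := by
  unfold nearKernel
  refine Measurable.ite ?_ ?_ measurable_const
  · have h1 : MeasurableSet {z : Total n × Horiz n | 0 < z.1.2} :=
      measurableSet_lt (by fun_prop) (by fun_prop)
    have h2 : MeasurableSet {z : Total n × Horiz n | z.1.2 < 5 / 4 * η z.1.1} :=
      measurableSet_lt (by fun_prop) (by fun_prop)
    have h3 : MeasurableSet {z : Total n × Horiz n | ‖z.1.1 - z.2‖ ≤ 13 / 40 * z.1.2} :=
      measurableSet_le (by fun_prop) (by fun_prop)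
    exact (h1.inter h2).inter h3
  · exact Measurable.mul (by fun_prop) (measurable_incr hg (by fun_prop) (by fun_prop))

/-- On the support the height exceeds `‖X - Y‖`, so `a` may be replaced by `max a ‖X - Y‖`, whose
power is integrable down to height zero. -/
lemma lintegral_nearKernel_fiber_le {s p : ℝ} (hn : 1 ≤ n) (hs : 0 < s) (hp : 1 ≤ p)
    (η g : Horiz n → ℝ) (X Y : Horiz n) {r : ℝ} (hr : r = (n : ℝ) + s * p) :
    ∫⁻ a : ℝ, nearKernel s p η g (X, a) Y ≤
      ENNReal.ofReal (r / (r - 1) * ‖X - Y‖ ^ (1 - r)) * incr p g X Y := by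
  rcases eq_or_ne X Y with rfl | hXY
  · simp [nearKernel, incr_self hp]
  have hd : 0 < ‖X - Y‖ := norm_pos_iff.2 (sub_ne_zero.2 hXY)
  have hn' : (1 : ℝ) ≤ n := by exact_mod_cast hn
  have hsp : 0 < s * p := by positivity
  calc _ ≤ ∫⁻ a in Ioi (0 : ℝ), ENNReal.ofReal (max a ‖X - Y‖ ^ (-r)) * incr p g X Y := by
        refine lintegral_le_setLIntegral_of_le measurableSet_Ioi (fun a ha => ?_) fun a ha => ?_
        · have ha0 : 0 < a := ha
          unfold nearKernel
          split_ifs with h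
          · have h2 : ‖X - Y‖ ≤ 13 / 40 * a := h.2
            rw [max_eq_left (by linarith), hr]
          · exact zero_le
        · simp [nearKernel, show ¬ 0 < a from ha]
    _ ≤ _ := by
        rw [lintegral_mul_const' _ _ (incr_ne_top hp g X Y)]
        gcongr
        exact lintegral_max_rpow_le (by linarith) hd

lemma lintegral_nearKernel_le {s p : ℝ} (hn : 1 ≤ n) (hs : 0 < s) (hp : 1 ≤ p)
    {η g : Horiz n → ℝ} (hηm : Measurable η) (hg : Measurable g) {r : ℝ}
    (hr : r = (n : ℝ) + s * p) :
    ∫⁻ x : Total n, ∫⁻ Y, nearKernel s p η g x Y ≤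
      ENNReal.ofReal (r / (r - 1)) * (shortEnergy s p η g + longEnergy s p η g) := by
  have hn' : (1 : ℝ) ≤ n := by exact_mod_cast hn
  have hsp : 0 < s * p := by positivity
  have hm := measurable_nearKernel (s := s) (p := p) hηm hg
  have h1 : ∫⁻ x : Total n, ∫⁻ Y, nearKernel s p η g x Y =
      ∫⁻ X : Horiz n, ∫⁻ Y : Horiz n, ∫⁻ a : ℝ, nearKernel s p η g (X, a) Y := by
    rw [Measure.volume_eq_prod, lintegral_prod _ hm.lintegral_prod_right'.aemeasurable]
    refine lintegral_congr fun X => ?_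
    refine lintegral_lintegral_swap (Measurable.aemeasurable ?_)
    exact hm.comp (Measurable.prodMk (by fun_prop) (by fun_prop))
  rw [h1]
  have hr1 : 0 < r - 1 := by linarith
  have hr0 : 0 < r := by linarith
  refine lintegral_le_of_le_energies hηm hg ENNReal.ofReal_ne_top (fun X Y _ => ?_)
    fun X Y hY => ?_
  · refine (lintegral_nearKernel_fiber_le hn hs hp η g X Y hr).trans (le_of_eq ?_)
    rw [mul_left_comm, ← ENNReal.ofReal_mul (by positivity), mul_comm (incr p g X Y), ← hr,
      neg_sub]
  -- The support forces `‖X - Y‖ < 13 / 40 * 5 / 4 * η X = 13 / 32 * η X`, inside the short-range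
  -- ball.
  · have : ∀ a : ℝ, nearKernel s p η g (X, a) Y = 0 := by
      intro a
      refine if_neg ?_
      rintro ⟨⟨h1, h2⟩, h3⟩
      simp only at h1 h2 h3
      rw [mem_compl_iff, Metric.mem_ball, dist_comm, dist_eq_norm, not_lt] at hY
      linarith
    simp [this]

/-- The substitution `Y = x.1 + (x.2 / 8) • v` supplies the factor `(x.2 / 8) ^ (-n)`. The constant
`13 / 40` is `1 / 5 + 1 / 8`, and `5 / 4` comes from `η` dropping by at most `x.2 / 5`. -/
lemma lintegral_incr_le_nearKernel {s p : ℝ} {η g : Horiz n → ℝ}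
    (hη : LipschitzWith 1 η) (hg : Measurable g) {x : Total n} (hx : x ∈ stripDomain η)
    {w : Horiz n} (hw : ‖w‖ ≤ 1 / 5) :
    ENNReal.ofReal (x.2 ^ (-(s * p))) * ∫⁻ v in Metric.closedBall (0 : Horiz n) 1,
        incr p g (x.1 + x.2 • w) (x.1 + (x.2 / 8) • v) ≤
      ENNReal.ofReal (8 ^ (n : ℝ)) * ∫⁻ Y, nearKernel s p η g (x.1 + x.2 • w, x.2) Y := by
  obtain ⟨hx0, hx1⟩ := hx
  set X := x.1 + x.2 • w with hX
  have hBm : MeasurableSet (Metric.closedBall (0 : Horiz n) 1) :=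
    Metric.isClosed_closedBall.measurableSet
  have hBx : MeasurableSet (Metric.closedBall x.1 (x.2 / 8)) :=
    Metric.isClosed_closedBall.measurableSet
  have hx8 : 0 < x.2 / 8 := by positivity
  set f : Horiz n → ℝ≥0∞ := (Metric.closedBall x.1 (x.2 / 8)).indicator (incr p g X) with hf
  have hfm : Measurable f := (measurable_incr hg measurable_const measurable_id).indicator hBx
  have hxw : ‖x.2 • w‖ ≤ x.2 / 5 := by
    rw [norm_smul, Real.norm_eq_abs, abs_of_pos hx0]
    nlinarith
  have hXη : x.2 < 5 / 4 * η X := by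
    have h2 := hη.dist_le_mul x.1 X
    rw [hX, Real.dist_eq, dist_self_add_right, NNReal.coe_one, one_mul] at h2
    rw [hX]
    linarith [(abs_le.1 h2).2]
  have h1 : ∫⁻ v in Metric.closedBall (0 : Horiz n) 1, incr p g X (x.1 + (x.2 / 8) • v) ≤
      ENNReal.ofReal ((x.2 / 8) ^ (-(n : ℝ))) * ∫⁻ Y, f Y := by
    have h2 := lintegral_comp_add_smul volume hfm x.1 hx8
    rw [finrank_euclideanSpace, Fintype.card_fin] at h2
    rw [← h2, ← lintegral_indicator hBm]
    refine lintegral_mono fun v => ?_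
    by_cases hv : v ∈ Metric.closedBall (0 : Horiz n) 1
    · have : x.1 + (x.2 / 8) • v ∈ Metric.closedBall x.1 (x.2 / 8) := by
        rw [Metric.mem_closedBall, dist_self_add_left, norm_smul, Real.norm_eq_abs,
          abs_of_pos hx8]
        exact mul_le_of_le_one_right hx8.le (mem_closedBall_zero_iff.1 hv)
      simp only [hf, indicator_of_mem hv, indicator_of_mem this]
      exact le_rfl
    · simp [hv]
  refine (mul_le_mul_right h1 _).trans ?_
  rw [← mul_assoc, ← lintegral_const_mul _ hfm, ← lintegral_const_mul' _ _ ENNReal.ofReal_ne_top]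
  refine lintegral_mono fun Y => ?_
  by_cases hY : Y ∈ Metric.closedBall x.1 (x.2 / 8)
  · have hXY : ‖X - Y‖ ≤ 13 / 40 * x.2 := by
      rw [Metric.mem_closedBall, dist_comm, dist_eq_norm] at hY
      have : X - Y = x.2 • w + (x.1 - Y) := by rw [hX]; abel
      rw [this]
      linarith [norm_add_le (x.2 • w) (x.1 - Y)]
    simp only [hf, indicator_of_mem hY]
    rw [nearKernel, if_pos ⟨⟨hx0, hXη⟩, hXY⟩, ← mul_assoc, ← ENNReal.ofReal_mul (by positivity),
      ← ENNReal.ofReal_mul (by positivity)]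
    refine le_of_eq ?_
    congr 2
    rw [Real.div_rpow hx0.le (by norm_num), Real.rpow_neg (by norm_num : (0 : ℝ) ≤ 8),
      div_inv_eq_mul, ← mul_assoc, ← Real.rpow_add hx0, mul_comm]
    congr 2
    ring
  · simp [hf, hY]

lemma exists_lintegral_near_le {s p : ℝ} (hn : 1 ≤ n) (hs : 0 < s) (hp : 1 ≤ p) :
    ∃ C : ℝ≥0∞, C ≠ ⊤ ∧ ∀ η g : Horiz n → ℝ, LipschitzWith 1 η → Measurable g →
      ∫⁻ x in stripDomain η, ENNReal.ofReal (x.2 ^ (-(s * p))) *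
        ∫⁻ w in Metric.closedBall (0 : Horiz n) (1 / 5),
        ∫⁻ v in Metric.closedBall (0 : Horiz n) 1,
          incr p g (x.1 + x.2 • w) (x.1 + (x.2 / 8) • v) ≤
      C * (shortEnergy s p η g + longEnergy s p η g) := by
  set r : ℝ := (n : ℝ) + s * p with hr
  set B := Metric.closedBall (0 : Horiz n) (1 / 5) with hB
  have hBm : MeasurableSet B := Metric.isClosed_closedBall.measurableSet
  refine ⟨ENNReal.ofReal (8 ^ (n : ℝ)) * (volume B * ENNReal.ofReal (r / (r - 1))), ?_,
    fun η g hηL hg => ?_⟩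
  · have : volume B ≠ ⊤ := measure_closedBall_lt_top.ne
    finiteness
  have hηm : Measurable η := hηL.continuous.measurable
  have hm := measurable_nearKernel (s := s) (p := p) hηm hg
  have hm' : Measurable fun x : Total n => ∫⁻ Y, nearKernel s p η g x Y := hm.lintegral_prod_right'
  calc _ ≤ ∫⁻ x in stripDomain η, ENNReal.ofReal (8 ^ (n : ℝ)) *
        ∫⁻ w in B, ∫⁻ Y, nearKernel s p η g (x.1 + x.2 • w, x.2) Y := by
        refine setLIntegral_mono' (measurableSet_stripDomain hηm) fun x hx => ?_
        rw [← lintegral_const_mul' _ _ ENNReal.ofReal_ne_top,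
          ← lintegral_const_mul' _ _ ENNReal.ofReal_ne_top]
        exact setLIntegral_mono' hBm fun w hw =>
          lintegral_incr_le_nearKernel hηL hg hx (mem_closedBall_zero_iff.1 hw)
    _ ≤ ∫⁻ x : Total n, ENNReal.ofReal (8 ^ (n : ℝ)) *
        ∫⁻ w in B, ∫⁻ Y, nearKernel s p η g (x.1 + x.2 • w, x.2) Y :=
        setLIntegral_le_lintegral _ _
    _ = ENNReal.ofReal (8 ^ (n : ℝ)) *
        ∫⁻ w in B, ∫⁻ x : Total n, ∫⁻ Y, nearKernel s p η g (x.1 + x.2 • w, x.2) Y := by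
        rw [lintegral_const_mul' _ _ ENNReal.ofReal_ne_top, lintegral_lintegral_swap]
        refine Measurable.aemeasurable ?_
        exact hm'.comp (Measurable.prodMk (by fun_prop) (by fun_prop))
    _ = ENNReal.ofReal (8 ^ (n : ℝ)) *
        ∫⁻ w in B, ∫⁻ x : Total n, ∫⁻ Y, nearKernel s p η g x Y := by
        congr 1
        refine lintegral_congr fun w => ?_
        exact lintegral_shear (f := fun a => a • w) (by fun_prop) hm'
    _ ≤ _ := by
        rw [setLIntegral_const, mul_assoc, mul_comm _ (volume B), mul_assoc]
        gcongr
        exact lintegral_nearKernel_le hn hs hp hηm hg hr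

end Near

/-! ### The seminorm estimate -/

section Estimate

variable {n : ℕ} {φ : Horiz n → ℝ}

lemma norm_le_eDist (x y : Total n) : ‖x - y‖ ≤ eDist x y := by
  unfold eDist
  refine max_le ?_ ?_
  · refine Real.le_sqrt_of_sq_le ?_
    have := sq_nonneg (x.2 - y.2)
    simp only [Prod.fst_sub]
    linarith
  · refine Real.le_sqrt_of_sq_le ?_
    have := sq_nonneg ‖x.1 - y.1‖
    simp only [Prod.snd_sub, Real.norm_eq_abs, sq_abs]
    linarith

lemma ofReal_abs_rpow {p : ℝ} (hp : 1 ≤ p) (A : ℝ) : ENNReal.ofReal (|A| ^ p) = ‖A‖ₑ ^ p := by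
  rw [Real.enorm_eq_ofReal_abs, ENNReal.ofReal_rpow_of_nonneg (abs_nonneg A) (by linarith)]

lemma gagliardo_integrand_le {p q : ℝ} (hp : 1 ≤ p) (hq : 0 < q) (u : Total n → ℝ)
    (x y : Total n) : ENNReal.ofReal (|u x - u y| ^ p / eDist x y ^ q) ≤
      ENNReal.ofReal (‖x - y‖ ^ (-q)) * ‖u x - u y‖ₑ ^ p := by
  rcases eq_or_ne x y with rfl | hxy
  · simp [show p ≠ 0 by linarith]
  have hd : 0 < ‖x - y‖ := norm_pos_iff.2 (sub_ne_zero.2 hxy)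
  rw [← ofReal_abs_rpow hp, ← ENNReal.ofReal_mul (by positivity), Real.rpow_neg hd.le,
    mul_comm, div_eq_mul_inv]
  refine ENNReal.ofReal_le_ofReal ?_
  gcongr
  exact norm_le_eDist x y

/-- The weight of an interaction of close points. -/
lemma near_weight_le {p q a d : ℝ} (hp : 1 ≤ p) (hq : 0 < q) (ha : 0 < a) (hd : 0 ≤ d) :
    ENNReal.ofReal (d ^ (-q)) * ENNReal.ofReal (d / a) ^ p ≤
      ENNReal.ofReal (d ^ (p - q)) * ENNReal.ofReal (a ^ (-p)) := by
  rcases hd.eq_or_lt with rfl | hd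
  -- At distance zero the convention `0 ^ (-q) = 0` makes the left side vanish.
  · simp [Real.zero_rpow (neg_ne_zero.2 hq.ne')]
  · rw [ENNReal.ofReal_rpow_of_nonneg (by positivity) (by linarith),
      ← ENNReal.ofReal_mul (by positivity), ← ENNReal.ofReal_mul (by positivity)]
    refine le_of_eq ?_
    congr 1
    rw [Real.div_rpow hd.le ha.le, Real.rpow_neg ha.le, ← div_eq_mul_inv, ← mul_div_assoc,
      ← Real.rpow_add hd]
    congr 2
    ring

/-- The integrand is bounded by a near term that depends on `y` only through an explicit weight,
plus a far term; the weight is integrated in `y` before the energy bounds are applied. -/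
lemma IsMollifier.exists_gagliardo_energy_le (hφ : IsMollifier φ) {s p : ℝ} (hn : 1 ≤ n)
    (hs0 : 0 < s) (hs1 : s < 1) (hp : 1 ≤ p) :
    ∃ C : ℝ≥0∞, C ≠ ⊤ ∧ ∀ η g : Horiz n → ℝ, (∀ x, 0 ≤ η x) → LipschitzWith 1 η →
      Measurable g → LocallyIntegrable g →
      ∫⁻ x in stripDomain η, ∫⁻ y in stripDomain η,
        ENNReal.ofReal (|extension φ g x - extension φ g y| ^ p /
          eDist x y ^ ((n : ℝ) + 1 + s * p)) ≤
      C * (shortEnergy s p η g + longEnergy s p η g) := by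
  obtain ⟨C₁, hC₁, h₁⟩ := hφ.exists_extension_sub_le hp
  obtain ⟨C₂, hC₂, h₂⟩ := hφ.exists_extension_sub_le_of_near hp
  obtain ⟨C₃, hC₃, h₃⟩ := exists_lintegral_far_le hn hs0 hp
  obtain ⟨C₄, hC₄, h₄⟩ := exists_lintegral_near_le hn hs0 hp
  set q : ℝ := (n : ℝ) + 1 + s * p with hq
  have hq0 : 0 < q := by positivity
  have hfin : (Module.finrank ℝ (Total n) : ℝ) = n + 1 := by
    simp [Module.finrank_prod]
  have hvol : (volume : Measure (Total n)).IsAddHaarMeasure :=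
    Measure.prod.instIsAddHaarMeasure _ _
  -- The integrability condition `-(n + 1) < p - q` says `0 < p * (1 - s)`, which is where `s < 1`
  -- enters.
  obtain ⟨C₅, hC₅, h₅⟩ := exists_lintegral_norm_rpow_le (volume : Measure (Total n))
    (by simp [Module.finrank_prod]) (α := p - q) (by rw [hfin]; nlinarith)
  refine ⟨C₅ * C₂ * C₄ + C₁ * C₃, by finiteness, fun η g hη hηL hg hgl => ?_⟩
  have hηm : Measurable η := hηL.continuous.measurable
  have hΩ := measurableSet_stripDomain hηm
  set Ω := stripDomain η with hΩdef
  set I : Total n → ℝ≥0∞ := fun x => ∫⁻ w in Metric.closedBall (0 : Horiz n) (1 / 5),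
    ∫⁻ v in Metric.closedBall (0 : Horiz n) 1,
      incr p g (x.1 + x.2 • w) (x.1 + (x.2 / 8) • v) with hI
  have hIm : Measurable I := by
    have : Measurable fun z : (Total n × Horiz n) × Horiz n =>
        incr p g (z.1.1.1 + z.1.1.2 • z.1.2) (z.1.1.1 + (z.1.1.2 / 8) • z.2) :=
      measurable_incr hg (by fun_prop) (by fun_prop)
    exact (this.lintegral_prod_right'
      (ν := volume.restrict (Metric.closedBall (0 : Horiz n) 1))).lintegral_prod_right'
  set far : Total n → Total n → ℝ≥0∞ := fun x y => if ‖x - y‖ < x.2 / 16 then 0 else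
        ENNReal.ofReal (‖x - y‖ ^ (-q)) *
        ∫⁻ w in Metric.closedBall (0 : Horiz n) 1, ∫⁻ v in Metric.closedBall (0 : Horiz n) 1,
          incr p g (x.1 + (x.2 / 8) • w) (y.1 + (y.2 / 8) • v) with hfar
  set wt : Total n → Total n → ℝ≥0∞ := fun x => (Metric.ball x x.2).indicator
    (fun y => ENNReal.ofReal (‖x - y‖ ^ (p - q))) with hwt
  have hwm : ∀ x, Measurable (wt x) := fun x => by
    refine Measurable.indicator ?_ measurableSet_ball
    exact ((measurable_const.sub measurable_id).norm.pow_const _).ennreal_ofReal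
  have hpt : ∀ x ∈ Ω, ∀ y ∈ Ω, ENNReal.ofReal (|extension φ g x - extension φ g y| ^ p /
      eDist x y ^ q) ≤ wt x y * (ENNReal.ofReal (x.2 ^ (-p)) * (C₂ * I x)) + C₁ * far x y := by
    intro x hx y hy
    refine (gagliardo_integrand_le hp hq0 _ x y).trans ?_
    by_cases hxy : ‖x - y‖ < x.2 / 16
    · refine le_trans ?_ le_self_add
      have hmem : y ∈ Metric.ball x x.2 := by
        rw [Metric.mem_ball, dist_comm, dist_eq_norm]
        linarith [hx.1]
      have e1 := h₂ g hg hgl x y hx.1 hxy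
      simp only [hwt, indicator_of_mem hmem]
      calc _ ≤ ENNReal.ofReal (‖x - y‖ ^ (-q)) *
            (C₂ * (ENNReal.ofReal (‖x - y‖ / x.2) ^ p * I x)) := by
            gcongr
            exact e1
        _ = (ENNReal.ofReal (‖x - y‖ ^ (-q)) * ENNReal.ofReal (‖x - y‖ / x.2) ^ p) *
            (C₂ * I x) := by ring
        _ ≤ (ENNReal.ofReal (‖x - y‖ ^ (p - q)) * ENNReal.ofReal (x.2 ^ (-p))) * (C₂ * I x) := by
            exact mul_le_mul_left (near_weight_le hp hq0 hx.1 (norm_nonneg (x - y))) _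
        _ = _ := by ring
    · refine le_trans ?_ le_add_self
      simp only [hfar, if_neg hxy]
      rw [mul_left_comm]
      gcongr
      exact h₁ g hg hgl x y hx.1 hy.1
  have hin : ∀ x ∈ Ω, ∫⁻ y in Ω, ENNReal.ofReal (|extension φ g x - extension φ g y| ^ p /
      eDist x y ^ q) ≤
      C₅ * C₂ * (ENNReal.ofReal (x.2 ^ (-(s * p))) * I x) + C₁ * ∫⁻ y in Ω, far x y := by
    intro x hx
    refine (setLIntegral_mono' hΩ (hpt x hx)).trans ?_
    rw [lintegral_add_left ((hwm x).mul_const _), lintegral_const_mul' _ _ hC₁,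
      lintegral_mul_const _ (hwm x)]
    gcongr ?_ + _
    have e2 : ∫⁻ y in Ω, wt x y ≤ C₅ * ENNReal.ofReal (x.2 ^ ((n : ℝ) + 1 + (p - q))) := by
      refine (setLIntegral_le_lintegral _ _).trans ?_
      have := h₅ x x.2 hx.1
      rwa [hfin] at this
    refine (mul_le_mul_left e2 _).trans (le_of_eq ?_)
    -- The powers of the height combine as `(n + 1 + p - q) - p = -(s * p)`.
    have e3 : ENNReal.ofReal (x.2 ^ (-(s * p))) =
        ENNReal.ofReal (x.2 ^ ((n : ℝ) + 1 + (p - q))) * ENNReal.ofReal (x.2 ^ (-p)) := by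
      have hx0 : 0 < x.2 := hx.1
      rw [← ENNReal.ofReal_mul (by positivity), ← Real.rpow_add hx0]
      congr 2
      rw [hq]
      ring
    rw [e3]
    ring
  refine (setLIntegral_mono' hΩ hin).trans ?_
  have hNm : Measurable fun x : Total n => ENNReal.ofReal (x.2 ^ (-(s * p))) * I x :=
    Measurable.mul (by fun_prop) hIm
  rw [lintegral_add_left (hNm.const_mul _), lintegral_const_mul _ hNm,
    lintegral_const_mul' _ _ hC₁, add_mul, mul_assoc (C₅ * C₂), mul_assoc C₁]
  gcongr
  · exact h₄ η g hηL hg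
  · exact h₃ η g hη hηL hg

lemma shortRange_eq {s p : ℝ} (hp : 1 ≤ p) (η g : Horiz n → ℝ) :
    shortRange (s - 1 / p) p η g = shortEnergy s p η g ^ (1 / p) := by
  have hp0 : p ≠ 0 := by linarith
  unfold shortRange shortEnergy incr
  congr 1
  refine lintegral_congr fun X => lintegral_congr fun Y => ?_
  rw [← ofReal_abs_rpow hp, ← ENNReal.ofReal_mul (by positivity), Real.rpow_neg (norm_nonneg _),
    ← div_eq_mul_inv]
  congr 3
  field_simp
  ring

lemma longRange_eq {s p : ℝ} (hp : 1 ≤ p) {η : Horiz n → ℝ} (g : Horiz n → ℝ) :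
    longRange (s + 1 / p) p η g = longEnergy s p η g ^ (1 / p) := by
  have hp0 : p ≠ 0 := by linarith
  unfold longRange longEnergy incr
  congr 1
  refine lintegral_congr fun X => lintegral_congr fun Y => ?_
  rw [← ofReal_abs_rpow hp, ← ENNReal.ofReal_mul (by positivity), Real.rpow_neg (norm_nonneg _),
    show (n : ℝ) + (s + 1 / p) * p = n + 1 + s * p by field_simp; ring]
  congr 1
  ring

lemma shortEnergy_congr_ae {s p : ℝ} {η g g' : Horiz n → ℝ} (h : g =ᵐ[volume] g') :
    shortEnergy s p η g = shortEnergy s p η g' := by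
  refine lintegral_congr_ae ?_
  filter_upwards [h] with X hX
  refine lintegral_congr_ae ?_
  filter_upwards [ae_restrict_of_ae h] with Y hY
  rw [incr, incr, hX, hY]

lemma longEnergy_congr_ae {s p : ℝ} {η g g' : Horiz n → ℝ} (h : g =ᵐ[volume] g') :
    longEnergy s p η g = longEnergy s p η g' := by
  refine lintegral_congr_ae ?_
  filter_upwards [h] with X hX
  refine lintegral_congr_ae ?_
  filter_upwards [ae_restrict_of_ae h] with Y hY
  rw [incr, incr, hX, hY]

lemma gagliardo_congr {s p : ℝ} {Ω : Set (Total n)} (hΩ : MeasurableSet Ω) {u v : Total n → ℝ}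
    (h : EqOn u v Ω) : gagliardo s p Ω u = gagliardo s p Ω v := by
  unfold gagliardo
  congr 1
  refine setLIntegral_congr_fun hΩ fun x hx => setLIntegral_congr_fun hΩ fun y hy => ?_
  simp only [h hx, h hy]

/-- A measurable representative of `g` leaves all three seminorms unchanged, so the energy estimate
applies; the root `1 / p ≤ 1` is subadditive and separates the two energies. -/
lemma IsMollifier.exists_gagliardo_extension_le (hφ : IsMollifier φ) {s p : ℝ} (hn : 1 ≤ n)
    (hs0 : 0 < s) (hs1 : s < 1) (hp : 1 ≤ p) :
    ∃ C : ℝ≥0∞, C ≠ ⊤ ∧ ∀ η g : Horiz n → ℝ, (∀ x, 0 ≤ η x) → LipschitzWith 1 η →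
      LocallyIntegrable g → gagliardo s p (stripDomain η) (extension φ g) ≤
      C * (shortRange (s - 1 / p) p η g + longRange (s + 1 / p) p η g) := by
  obtain ⟨C, hC, h⟩ := hφ.exists_gagliardo_energy_le hn hs0 hs1 hp
  have hp' : 0 ≤ 1 / p := by positivity
  refine ⟨C ^ (1 / p), ENNReal.rpow_ne_top_of_nonneg hp' hC, fun η g hη hηL hg => ?_⟩
  have hΩ := measurableSet_stripDomain hηL.continuous.measurable
  set g' := hg.aestronglyMeasurable.mk g
  have hgg' : g =ᵐ[volume] g' := hg.aestronglyMeasurable.ae_eq_mk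
  have hg'm : Measurable g' := hg.aestronglyMeasurable.stronglyMeasurable_mk.measurable
  have hg'l : LocallyIntegrable g' := hg.congr hgg'
  rw [gagliardo_congr hΩ fun x hx => extension_congr_ae hgg' hx.1, shortRange_eq hp,
    longRange_eq hp, shortEnergy_congr_ae hgg', longEnergy_congr_ae hgg']
  calc _ ≤ (C * (shortEnergy s p η g' + longEnergy s p η g')) ^ (1 / p) :=
        ENNReal.rpow_le_rpow (h η g' hη hηL hg'm hg'l) hp'
    _ = C ^ (1 / p) * (shortEnergy s p η g' + longEnergy s p η g') ^ (1 / p) :=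
        ENNReal.mul_rpow_of_nonneg _ _ hp'
    _ ≤ _ := by
        gcongr
        exact ENNReal.rpow_add_le_add_rpow _ _ hp' (by rw [div_le_one (by linarith)]; exact hp)

end Estimate

end OneSided

end

theorem mainTheorem1 (n : ℕ) (hn : 1 ≤ n) (s p : ℝ) (hs0 : 0 < s) (hs1 : s < 1) (hp : 1 ≤ p)
    (φ : OneSided.Horiz n → ℝ) (hφ : OneSided.IsMollifier φ) :
    -- `u` is given by a convergent integral, and `g ↦ u` is linear
    (∀ g : OneSided.Horiz n → ℝ, OneSided.MemLpLoc p Set.univ g →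
      ∀ x : OneSided.Total n, 0 < x.2 →
        Integrable (fun w : OneSided.Horiz n => φ w * g (x.1 + (x.2 / 8) • w))) ∧
    (∀ g₁ g₂ : OneSided.Horiz n → ℝ,
      OneSided.MemLpLoc p Set.univ g₁ → OneSided.MemLpLoc p Set.univ g₂ →
      ∀ (a b : ℝ) (x : OneSided.Total n), 0 < x.2 →
        OneSided.extension φ (fun z => a * g₁ z + b * g₂ z) x =
          a * OneSided.extension φ g₁ x + b * OneSided.extension φ g₂ x) ∧
    -- membership and the estimate
    ∃ C : ℝ, 0 < C ∧
      ∀ η : OneSided.Horiz n → ℝ, (∀ x, 0 ≤ η x) → LipschitzWith 1 η →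
      ∀ g : OneSided.Horiz n → ℝ, OneSided.MemLpLoc p Set.univ g →
        OneSided.shortRange (s - 1 / p) p η g < ⊤ →
        OneSided.longRange (s + 1 / p) p η g < ⊤ →
        OneSided.MemHomogeneousSobolev s p (OneSided.stripDomain η) (OneSided.extension φ g) ∧
        ENNReal.ofReal C *
            OneSided.gagliardo s p (OneSided.stripDomain η) (OneSided.extension φ g) ≤
          OneSided.shortRange (s - 1 / p) p η g + OneSided.longRange (s + 1 / p) p η g := by
  refine ⟨fun g hg x hx => hφ.integrable_mul (hg.locallyIntegrable hp) x.1 (by positivity),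
    fun g₁ g₂ h₁ h₂ a b x hx => OneSided.extension_linear hφ (h₁.locallyIntegrable hp)
      (h₂.locallyIntegrable hp) a b hx, ?_⟩
  obtain ⟨C, hC, h⟩ := hφ.exists_gagliardo_extension_le hn hs0 hs1 hp
  -- Adding one keeps the constant invertible even if `C = 0`.
  have hK : 0 < C.toReal + 1 := by positivity
  refine ⟨(C.toReal + 1)⁻¹, by positivity, fun η hη hηL g hg hS hL => ?_⟩
  have hgl := hg.locallyIntegrable hp
  have key := h η g hη hηL hgl
  refine ⟨⟨OneSided.memLpLoc_extension hφ hgl η, key.trans_lt ?_⟩, ?_⟩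
  · exact ENNReal.mul_lt_top hC.lt_top (ENNReal.add_lt_top.2 ⟨hS, hL⟩)
  · have hCK : C ≤ ENNReal.ofReal (C.toReal + 1) := by
      rw [ENNReal.le_ofReal_iff_toReal_le hC hK.le]
      linarith
    refine (mul_le_mul_right (key.trans (mul_le_mul_left hCK _)) _).trans (le_of_eq ?_)
    rw [← mul_assoc, ← ENNReal.ofReal_mul (by positivity), inv_mul_cancel₀ hK.ne',
      ENNReal.ofReal_one, one_mul]
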